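/- Let $\beta\ge 0$ and $a>0$ be fixed, and write $(x-a)_+^\beta=(x-a)^\beta$ for $x>a$ and $(x-a)_+^\beta=0$ for $x\le a$. For a parameter $l\in\mathbb{R}$, $h>0$ and $C_h\in\mathbb{C}$ put $$\lambda_h=\frac{\pi l h}{a}+C_h\,h^{(\beta+4)/(\beta+2)} .$$ (Dirichlet case) For every $l\in\mathbb{Z}$ with $l\neq 0$ there exist $h_0>0$ and $K>0$ such that for all $h\in(0,h_0)$ there exist $C_h\in\mathbb{C}$ with $|C_h|<K$ and a function $v\in H^2(0,\infty)\cap H^1_0(0,\infty)$ (complex valued), $v\neq 0$, satisfying $$-h^2v''+i(x-a)_+^\beta v-\lambda_h^2 v=0 \quad\text{a.e. on } (0,\infty),\qquad v(0)=0 .$$ (Neumann case) For every $l\in\mathbb{R}$ with $l+\tfrac12\in\mathbb{Z}$ there exist $h_0>0$ and $K>0$ such that for all $h\in(0,h_0)$ there exist $C_h\in\mathbb{C}$ with $|C_h|<K$ and a function $v\in H^2(0,\infty)$ (complex valued), $v\neq 0$, satisfying $$-h^2v''+i(x-a)_+^\beta v-\lambda_h^2 v=0 \quad\text{a.e. on }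 (0,\infty),\qquad v'(0)=0 .$$ Here $v'$ and $v''$ are weak derivatives, and $v(0)$, $v'(0)$ are the values at $0$ of the representatives of $v$, $v'$ that are continuous on $[0,\infty)$. The constants $h_0$ and $K$ may depend on $\beta$, $a$ and $l$, but not on $h$. -/

import Mathlib

open MeasureTheory Filter
open scoped Topology Distributions

noncomputable section

/-- The open half-line `(0, ∞)`. -/
def halfLine : TopologicalSpace.Opens ℝ := ⟨Set.Ioi 0, isOpen_Ioi⟩

/-- Lebesgue measure on `(0, ∞)`. -/
abbrev halfLineMeasure : Measure ℝ := volume.restrict (Set.Ioi (0 : ℝ))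

/-- `g` is the weak derivative of `f` on `(0, ∞)`; both are locally integrable there, and
`∫ f φ' = -∫ g φ` for every test function `φ ∈ C_c^∞((0, ∞); ℂ)`.
Values on `(-∞, 0]` are irrelevant. -/
def HasWeakDeriv (f g : ℝ → ℂ) : Prop :=
  LocallyIntegrableOn f (Set.Ioi 0) ∧ LocallyIntegrableOn g (Set.Ioi 0) ∧
    ∀ φ : 𝓓(halfLine, ℂ),
      ∫ x in Set.Ioi (0 : ℝ), f x * deriv φ x = -∫ x in Set.Ioi (0 : ℝ), g x * φ x

/-- `v ∈ H²(0, ∞)`: `v` and its weak derivatives of orders one and two lie in `L²(0, ∞)`. -/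
def MemH2 (v : ℝ → ℂ) : Prop :=
  MemLp v 2 halfLineMeasure ∧ ∃ v₁ v₂ : ℝ → ℂ, HasWeakDeriv v v₁ ∧ HasWeakDeriv v₁ v₂ ∧
    MemLp v₁ 2 halfLineMeasure ∧ MemLp v₂ 2 halfLineMeasure

/-- `v ∈ H¹₀(0, ∞)`: `v ∈ H¹(0, ∞)` is the limit in the norm of `H¹(0, ∞)` of a sequence of
test functions `φₙ ∈ C_c^∞((0, ∞); ℂ)`. -/
def MemH10 (v : ℝ → ℂ) : Prop :=
  MemLp v 2 halfLineMeasure ∧ ∃ v₁ : ℝ → ℂ, HasWeakDeriv v v₁ ∧ MemLp v₁ 2 halfLineMeasure ∧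
    ∃ φ : ℕ → 𝓓(halfLine, ℂ),
      Tendsto (fun n => eLpNorm (fun x => v x - φ n x) 2 halfLineMeasure) atTop (𝓝 0) ∧
      Tendsto (fun n => eLpNorm (fun x => v₁ x - deriv (φ n) x) 2 halfLineMeasure) atTop (𝓝 0)

/-- `f(0) = c` for a class `f` of functions on `(0, ∞)` modulo null sets: `f` has a representative
that is continuous on `[0, ∞)` and takes the value `c` at `0`. -/
def HasBoundaryValue (f : ℝ → ℂ) (c : ℂ) : Prop :=
  ∃ g : ℝ → ℂ, ContinuousOn g (Set.Ici 0) ∧ f =ᵐ[halfLineMeasure] g ∧ g 0 = c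

/-- `v'(0) = c`, where `v'` is the weak derivative of `v` on `(0, ∞)`. -/
def HasBoundaryDeriv (v : ℝ → ℂ) (c : ℂ) : Prop :=
  ∃ v₁ : ℝ → ℂ, HasWeakDeriv v v₁ ∧ HasBoundaryValue v₁ c

/-- The function `(x - a)₊^β`, which vanishes for `x ≤ a`; for `β = 0` it is the indicator function
of `(a, ∞)`. -/
def absorbingPotential (β a x : ℝ) : ℝ :=
  if a < x then (x - a) ^ β else 0

/-- `-h² v'' + i (x - a)₊^β v - λ² v = 0` almost everywhere on `(0, ∞)`, where `v''` is the second
weak derivative. -/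
def SolvesCAP (β a h : ℝ) (lam : ℂ) (v : ℝ → ℂ) : Prop :=
  ∃ v₁ v₂ : ℝ → ℂ, HasWeakDeriv v v₁ ∧ HasWeakDeriv v₁ v₂ ∧
    ∀ᵐ x ∂halfLineMeasure,
      -(h : ℂ) ^ 2 * v₂ x + Complex.I * (absorbingPotential β a x : ℂ) * v x - lam ^ 2 * v x = 0

/-- `λ_h = π l h / a + C h^((β + 4) / (β + 2))`. -/
def capEigenvalue (β a l h : ℝ) (C : ℂ) : ℂ :=
  ((Real.pi * l * h / a : ℝ) : ℂ) + C * ((h ^ ((β + 4) / (β + 2)) : ℝ) : ℂ)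

end

/-! Write `λ = hκ` and `ε = h ^ (2 / (β + 2))`. On `[0, a]` the equation is `v'' = -κ² v`, and the
boundary condition at `0` selects `sin (κx)` or `cos (κx)`. For `x > a` the variable `y = (x - a) /
ε` turns it into `w'' = (i y ^ β - (εκ)²) w`, because `ε ^ (β + 2) = h ^ 2`. A solution `w = exp (∫
m)` decays when its logarithmic derivative `m` solves the Riccati equation `m' = i y ^ β - (εκ)² -
m²` with real part below a negative constant. The two pieces fit together in `C¹` exactly when `ε
S'(a) = m(0) S(a)`. With `κa = κ₀a + δ`, where `κ₀ = πl / a`, both boundary conditions give the same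
scalar equation `κ ε cos δ = m(0) sin δ`.

For `ε = 0` a suitable `m` comes from a WKB ansatz near infinity with a small correction found by
contraction (`exists_riccati_near_infty`). It is continued down to `0` through the linear equation:
`Re (w' conj w)` has derivative `|w'|² ≥ 0` and is negative far out, so it is negative on the way
down and `w` cannot vanish (`exists_riccati_solution`).

For small `ε` the correction of `m` and the phase `δ` are found together by the inverse function
theorem (`exists_matching`). The linearisation is invertible because `m(0) ≠ 0`, and it yields `δ =
O(ε)`. Since `hε = h ^ ((β + 4) / (β + 2))`, the shift `hδ / a` of the eigenvalue has the required
size, with `C = δ / (aε)`.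

What remains is regularity. The glued function and its first two derivatives decay exponentially,
and membership in `H¹₀` is shown by explicit test functions. -/

open scoped BoundedContinuousFunction

/-! ### Inverting the linearised Riccati equation on bounded functions -/

/-- The primitive of `g` that vanishes at `0`. -/
noncomputable def primitiveFromZero (g : ℝ → ℂ) (y : ℝ) : ℂ := ∫ t in (0 : ℝ)..y, g t

theorem primitiveFromZero_zero (g : ℝ → ℂ) : primitiveFromZero g 0 = 0 := by
  simp [primitiveFromZero]

theorem hasDerivAt_primitiveFromZero {g : ℝ → ℂ} (hg : Continuous g) (y : ℝ) :
    HasDerivAt (primitiveFromZero g) (g y) y :=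
  (hg.integral_hasStrictDerivAt 0 y).hasDerivAt

theorem continuous_primitiveFromZero {g : ℝ → ℂ} (hg : Continuous g) :
    Continuous (primitiveFromZero g) :=
  continuous_iff_continuousAt.2 fun y => (hasDerivAt_primitiveFromZero hg y).continuousAt

theorem re_primitiveFromZero_sub_le {g : ℝ → ℂ} (hg : Continuous g) {c : ℝ}
    (hc : ∀ y, (g y).re ≤ -c) {y t : ℝ} (hyt : y ≤ t) :
    (primitiveFromZero g t - primitiveFromZero g y).re ≤ -(c * (t - y)) := by
  have hd : ∀ x, HasDerivAt (fun x => (primitiveFromZero g x).re + c * x) ((g x).re + c) x := by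
    intro x
    have h1 : HasDerivAt (fun x => (primitiveFromZero g x).re) ((g x).re) x :=
      (Complex.reCLM.hasFDerivAt.comp_hasDerivAt x (hasDerivAt_primitiveFromZero hg x))
    simpa only [mul_one, id_eq] using h1.fun_add ((hasDerivAt_id x).const_mul c)
  have hanti : Antitone (fun x => (primitiveFromZero g x).re + c * x) :=
    antitone_of_hasDerivAt_nonpos hd fun x => by
      have := hc x
      show (g x).re + c ≤ 0
      linarith
  have := hanti hyt
  simp only [Complex.sub_re] at *
  linarith

section BackwardOperator

variable {g : ℝ → ℂ} {c : ℝ}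

theorem norm_exp_two_primitive_le (hg : Continuous g) (hc : ∀ y, (g y).re ≤ -c) {y t : ℝ}
    (hyt : y ≤ t) :
    ‖Complex.exp (2 * (primitiveFromZero g t - primitiveFromZero g y))‖
      ≤ Real.exp (-(2 * c) * (t - y)) := by
  rw [Complex.norm_exp]
  apply Real.exp_le_exp.2
  have := re_primitiveFromZero_sub_le hg hc hyt
  simp only [Complex.mul_re, Complex.re_ofNat, Complex.im_ofNat, zero_mul, sub_zero]
  linarith

theorem integrableOn_exp_Ioi_sub (hc0 : 0 < c) (y : ℝ) :
    IntegrableOn (fun t => Real.exp (-(2 * c) * (t - y))) (Set.Ioi y) := by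
  have h := (integrableOn_exp_mul_Ioi (a := -(2 * c)) (by linarith) y).const_mul
    (Real.exp (2 * c * y))
  refine h.congr (ae_of_all _ fun t => ?_)
  simp only
  rw [← Real.exp_add]; ring_nf

theorem integral_exp_Ioi_sub (hc0 : 0 < c) (y : ℝ) :
    ∫ t in Set.Ioi y, Real.exp (-(2 * c) * (t - y)) = 1 / (2 * c) := by
  have h := integral_exp_mul_Ioi (a := -(2 * c)) (by linarith) y
  have : ∀ t, Real.exp (-(2 * c) * (t - y)) = Real.exp (2 * c * y) * Real.exp (-(2 * c) * t) := by
    intro t; rw [← Real.exp_add]; ring_nf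
  simp_rw [this]
  rw [integral_const_mul, h, neg_div_neg_eq, ← mul_div_assoc, ← Real.exp_add]
  congr 1
  simp

theorem integrableOn_exp_two_primitive_mul (hg : Continuous g) (hc0 : 0 < c)
    (hc : ∀ y, (g y).re ≤ -c) (f : ℝ →ᵇ ℂ) (y : ℝ) :
    IntegrableOn (fun t => Complex.exp (2 * (primitiveFromZero g t - primitiveFromZero g y)) * f t)
      (Set.Ioi y) := by
  have hG := continuous_primitiveFromZero hg
  refine ((integrableOn_exp_Ioi_sub hc0 y).mul_const ‖f‖).mono'
    (Continuous.aestronglyMeasurable (by fun_prop)) ?_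
  refine (ae_restrict_iff' measurableSet_Ioi).2 (ae_of_all _ fun t ht => ?_)
  rw [norm_mul]
  exact mul_le_mul (norm_exp_two_primitive_le hg hc (le_of_lt ht)) (f.norm_coe_le_norm t)
    (norm_nonneg _) (Real.exp_pos _).le

/-- The solution `u` of `u' = -f - 2 g u` that is bounded at `∞`, where `Re g` is negative. -/
noncomputable def backwardSolution (g : ℝ → ℂ) (f : ℝ → ℂ) (y : ℝ) : ℂ :=
  ∫ t in Set.Ioi y, Complex.exp (2 * (primitiveFromZero g t - primitiveFromZero g y)) * f t

theorem norm_backwardSolution_le (hg : Continuous g) (hc0 : 0 < c)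
    (hc : ∀ y, (g y).re ≤ -c) (f : ℝ →ᵇ ℂ) (y : ℝ) :
    ‖backwardSolution g f y‖ ≤ 1 / (2 * c) * ‖f‖ := by
  rw [← integral_exp_Ioi_sub hc0 y, ← integral_mul_const]
  refine norm_integral_le_of_norm_le ((integrableOn_exp_Ioi_sub hc0 y).mul_const ‖f‖) ?_
  refine (ae_restrict_iff' measurableSet_Ioi).2 (ae_of_all _ fun t ht => ?_)
  rw [norm_mul]
  exact mul_le_mul (norm_exp_two_primitive_le hg hc (le_of_lt ht)) (f.norm_coe_le_norm t)
    (norm_nonneg _) (Real.exp_pos _).le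

/-- The exponential factors as `exp (-2G(y)) * exp (2G(t))` with `G` the primitive of `g`, so the
integral becomes a smooth factor times a tail integral and the product rule applies. -/
theorem hasDerivAt_backwardSolution (hg : Continuous g) (hc0 : 0 < c)
    (hc : ∀ y, (g y).re ≤ -c) (f : ℝ →ᵇ ℂ) (y : ℝ) :
    HasDerivAt (backwardSolution g f) (-f y - 2 * g y * backwardSolution g f y) y := by
  have hG := continuous_primitiveFromZero hg
  set F : ℝ → ℂ := fun t => Complex.exp (2 * primitiveFromZero g t) * f t with hF
  have hFc : Continuous F := by fun_prop
  have hsplit : ∀ x, backwardSolution g f x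
      = Complex.exp (-(2 * primitiveFromZero g x)) * ∫ t in Set.Ioi x, F t := by
    intro x
    rw [backwardSolution, ← integral_const_mul]
    congr 1; ext t
    rw [hF, ← mul_assoc, ← Complex.exp_add]; ring_nf
  have hint : ∀ x, IntegrableOn F (Set.Ioi x) := by
    intro x
    refine ((integrableOn_exp_two_primitive_mul hg hc0 hc f x).const_mul
      (Complex.exp (2 * primitiveFromZero g x))).congr (ae_of_all _ fun t => ?_)
    simp only [hF]
    rw [← mul_assoc, ← Complex.exp_add]; ring_nf
  have htail : ∀ x, ∫ t in Set.Ioi x, F t = (∫ t in Set.Ioi 0, F t) - ∫ t in (0 : ℝ)..x, F t := by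
    intro x
    rw [eq_sub_iff_add_eq, add_comm,
      intervalIntegral.integral_interval_add_Ioi (hint 0) (hint x)]
  have hd : HasDerivAt (fun x => ∫ t in Set.Ioi x, F t) (-F y) y := by
    rw [funext htail]
    exact (hFc.integral_hasStrictDerivAt 0 y).hasDerivAt.const_sub _
  have hE : HasDerivAt (fun x => Complex.exp (-(2 * primitiveFromZero g x)))
      (Complex.exp (-(2 * primitiveFromZero g y)) * -(2 * g y)) y :=
    (((hasDerivAt_primitiveFromZero hg y).const_mul 2).neg).cexp
  have h := hE.mul hd
  have hfun : backwardSolution g f = fun x =>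
      Complex.exp (-(2 * primitiveFromZero g x)) * ∫ t in Set.Ioi x, F t := funext hsplit
  rw [hsplit y, hfun]
  have h1 : Complex.exp (-(2 * primitiveFromZero g y)) * F y = f y := by
    rw [hF, ← mul_assoc, ← Complex.exp_add]; simp
  refine h.congr_deriv ?_
  linear_combination -h1

/-- `backwardSolution g` is a bounded operator on bounded continuous functions. -/
theorem exists_backward_operator (hg : Continuous g) (hc0 : 0 < c) (hc : ∀ y, (g y).re ≤ -c) :
    ∃ L : (ℝ →ᵇ ℂ) →L[ℂ] (ℝ →ᵇ ℂ), (∀ f, ‖L f‖ ≤ 1 / (2 * c) * ‖f‖) ∧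
      ∀ (f : ℝ →ᵇ ℂ) (y : ℝ), HasDerivAt (L f) (-f y - 2 * g y * L f y) y := by
  have hcont : ∀ f : ℝ →ᵇ ℂ, Continuous (backwardSolution g f) := fun f =>
    continuous_iff_continuousAt.2 fun y => (hasDerivAt_backwardSolution hg hc0 hc f y).continuousAt
  let l : (ℝ →ᵇ ℂ) →ₗ[ℂ] (ℝ →ᵇ ℂ) :=
    { toFun := fun f => BoundedContinuousFunction.ofNormedAddCommGroup (backwardSolution g f)
        (hcont f) _ (norm_backwardSolution_le hg hc0 hc f)
      map_add' := by
        intro f₁ f₂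
        ext y
        simp only [BoundedContinuousFunction.coe_ofNormedAddCommGroup,
          BoundedContinuousFunction.coe_add, Pi.add_apply, backwardSolution, mul_add]
        exact integral_add (integrableOn_exp_two_primitive_mul hg hc0 hc f₁ y)
          (integrableOn_exp_two_primitive_mul hg hc0 hc f₂ y)
      map_smul' := by
        intro k f
        ext y
        simp only [BoundedContinuousFunction.coe_ofNormedAddCommGroup,
          BoundedContinuousFunction.coe_smul, backwardSolution, smul_eq_mul,
          RingHom.id_apply]
        rw [← integral_const_mul]
        congr 1; ext t; ring }
  have hb : ∀ f, ‖l f‖ ≤ 1 / (2 * c) * ‖f‖ := fun f =>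
    (BoundedContinuousFunction.norm_le (by positivity)).2 (norm_backwardSolution_le hg hc0 hc f)
  exact ⟨l.mkContinuous _ hb, hb, fun f y => hasDerivAt_backwardSolution hg hc0 hc f y⟩

end BackwardOperator

/-! ### Two contraction arguments -/

/-- Picard–Lindelöf, global form: a globally Lipschitz, continuous vector field that vanishes at
the origin has an integral curve on `[0, ∞)` through every point. -/
theorem exists_integralCurve_of_lipschitz {E : Type*} [NormedAddCommGroup E] [NormedSpace ℝ E]
    [CompleteSpace E] {f : ℝ → E → E} (hf : Continuous (Function.uncurry f)) {M : ℝ} (hM : 0 < M)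
    (hlip : ∀ t x y, ‖f t x - f t y‖ ≤ M * ‖x - y‖) (hzero : ∀ t, f t 0 = 0) (u₀ : E) :
    ∃ u : ℝ → E, Continuous u ∧ u 0 = u₀ ∧ ∀ t ≥ 0, HasDerivAt u (f t (u t)) t := by
  -- The fixed point is sought for `U = exp (-kt) u`. In this weighted norm the integral operator
  -- has Lipschitz constant `M / k = 1 / 2`, on the whole half-line at once.
  set k : ℝ := 2 * M with hk
  have hk0 : 0 < k := by positivity
  let F : (ℝ →ᵇ E) → ℝ → E := fun U τ => f τ (Real.exp (k * τ) • U τ)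
  have hFc : ∀ U : ℝ →ᵇ E, Continuous (F U) := fun U =>
    hf.comp (continuous_id.prodMk (by fun_prop : Continuous fun τ => Real.exp (k * τ) • U τ))
  have hexp : ∀ t : ℝ, ∫ τ in (0 : ℝ)..t, Real.exp (k * τ) = (Real.exp (k * t) - 1) / k := by
    intro t
    rw [intervalIntegral.integral_comp_mul_left (fun x => Real.exp x) hk0.ne']
    simp [integral_exp]; field_simp
  have hint : ∀ (G : ℝ → E) (B : ℝ), 0 ≤ B → (∀ τ, ‖G τ‖ ≤ M * (Real.exp (k * τ) * B)) →
      ∀ t, 0 ≤ t → ‖∫ τ in (0 : ℝ)..t, G τ‖ ≤ Real.exp (k * t) * (B / 2) := by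
    intro G B hB hG t ht
    have h1 := intervalIntegral.norm_integral_le_of_norm_le ht
      (ae_of_all volume fun τ _ => hG τ)
      (Continuous.intervalIntegrable (by fun_prop) 0 t)
    refine h1.trans ?_
    rw [intervalIntegral.integral_const_mul, intervalIntegral.integral_mul_const, hexp]
    have : M * ((Real.exp (k * t) - 1) / k * B) = (Real.exp (k * t) - 1) * (B / 2) := by
      rw [hk]; field_simp
    rw [this]
    have := Real.exp_pos (k * t)
    nlinarith
  have hFb : ∀ (U : ℝ →ᵇ E) τ, ‖F U τ‖ ≤ M * (Real.exp (k * τ) * ‖U‖) := by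
    intro U τ
    have := hlip τ (Real.exp (k * τ) • U τ) 0
    rw [hzero, sub_zero, sub_zero, norm_smul, Real.norm_of_nonneg (Real.exp_pos _).le] at this
    refine this.trans ?_
    gcongr
    exact U.norm_coe_le_norm τ
  have hFd : ∀ (U V : ℝ →ᵇ E) τ, ‖F U τ - F V τ‖ ≤ M * (Real.exp (k * τ) * ‖U - V‖) := by
    intro U V τ
    refine (hlip τ _ _).trans ?_
    rw [← smul_sub, norm_smul, Real.norm_of_nonneg (Real.exp_pos _).le]
    gcongr
    exact (U - V).norm_coe_le_norm τ
  let P : (ℝ →ᵇ E) → ℝ → E := fun U t => u₀ + ∫ τ in (0 : ℝ)..t, F U τ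
  have hPd : ∀ U t, HasDerivAt (P U) (F U t) t := fun U t =>
    ((hFc U).integral_hasStrictDerivAt 0 t).hasDerivAt.const_add _
  have hPc : ∀ U, Continuous (P U) := fun U =>
    continuous_iff_continuousAt.2 fun t => (hPd U t).continuousAt
  have hTb : ∀ (U : ℝ →ᵇ E) t, ‖Real.exp (-(k * max t 0)) • P U (max t 0)‖ ≤ ‖u₀‖ + ‖U‖ / 2 := by
    intro U t
    have ht : 0 ≤ max t 0 := le_max_right _ _
    rw [norm_smul, Real.norm_of_nonneg (Real.exp_pos _).le]
    have h1 : ‖P U (max t 0)‖ ≤ ‖u₀‖ + Real.exp (k * max t 0) * (‖U‖ / 2) :=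
      (norm_add_le _ _).trans (add_le_add_right (hint _ _ (norm_nonneg _) (hFb U) _ ht) _)
    have h2 : Real.exp (-(k * max t 0)) ≤ 1 := Real.exp_le_one_iff.2 (by nlinarith)
    have h3 : Real.exp (-(k * max t 0)) * Real.exp (k * max t 0) = 1 := by
      rw [← Real.exp_add]; simp
    calc _ ≤ Real.exp (-(k * max t 0)) * (‖u₀‖ + Real.exp (k * max t 0) * (‖U‖ / 2)) := by gcongr
      _ = Real.exp (-(k * max t 0)) * ‖u₀‖ + ‖U‖ / 2 := by rw [mul_add, ← mul_assoc, h3, one_mul]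
      _ ≤ _ := by nlinarith [norm_nonneg u₀]
  -- Times are clamped to `max t 0`, since the weight controls the integral only for `t ≥ 0`.
  let T : (ℝ →ᵇ E) → (ℝ →ᵇ E) := fun U => BoundedContinuousFunction.ofNormedAddCommGroup
    (fun t => Real.exp (-(k * max t 0)) • P U (max t 0))
    (by have := hPc U; fun_prop) _ (hTb U)
  have hT : ContractingWith (1 / 2) T := by
    refine ⟨by norm_num, LipschitzWith.of_dist_le_mul fun U V => ?_⟩
    rw [dist_eq_norm, dist_eq_norm]
    refine (BoundedContinuousFunction.norm_le (by positivity)).2 fun t => ?_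
    have ht : 0 ≤ max t 0 := le_max_right _ _
    simp only [T, BoundedContinuousFunction.coe_sub, Pi.sub_apply,
      BoundedContinuousFunction.coe_ofNormedAddCommGroup]
    rw [← smul_sub, norm_smul, Real.norm_of_nonneg (Real.exp_pos _).le]
    have h1 : P U (max t 0) - P V (max t 0) = ∫ τ in (0 : ℝ)..(max t 0), (F U τ - F V τ) := by
      rw [intervalIntegral.integral_sub ((hFc U).intervalIntegrable _ _)
        ((hFc V).intervalIntegrable _ _)]
      simp only [P]; abel
    rw [h1]
    have h2 := hint _ _ (norm_nonneg _) (hFd U V) _ ht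
    have h3 : Real.exp (-(k * max t 0)) * Real.exp (k * max t 0) = 1 := by
      rw [← Real.exp_add]; simp
    calc _ ≤ Real.exp (-(k * max t 0)) * (Real.exp (k * max t 0) * (‖U - V‖ / 2)) := by gcongr
      _ = _ := by rw [← mul_assoc, h3]; norm_num; ring
  set U := hT.fixedPoint T with hU
  have hfix : ∀ t, 0 ≤ t → P U t = Real.exp (k * t) • U t := by
    intro t ht
    have h := congrArg (fun V : ℝ →ᵇ E => V t) hT.fixedPoint_isFixedPt
    simp only [T, BoundedContinuousFunction.coe_ofNormedAddCommGroup, max_eq_left ht] at h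
    rw [← hU] at h
    rw [← h, smul_smul, ← Real.exp_add]; simp
  refine ⟨P U, hPc U, by simp [P], fun t ht => ?_⟩
  rw [hfix t ht]
  exact hPd U t

/-- A quadratic fixed point equation `r = L (f + r²)` with `‖L‖ ≤ 1` and small `f`. -/
theorem exists_quadratic_fixedPoint (L : (ℝ →ᵇ ℂ) →L[ℂ] (ℝ →ᵇ ℂ)) (hL : ∀ f, ‖L f‖ ≤ ‖f‖)
    (f : ℝ →ᵇ ℂ) (hf : ‖f‖ ≤ 1 / 16) : ∃ r : ℝ →ᵇ ℂ, ‖r‖ ≤ 1 / 4 ∧ r = L (f + r * r) := by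
  -- On the ball of radius `1 / 4`, `‖f‖ + ‖r‖² ≤ 1 / 8`, and `r² - r'² = (r + r')(r - r')` gives
  -- the contraction factor `1 / 2`.
  set s : Set (ℝ →ᵇ ℂ) := Metric.closedBall 0 (1 / 4) with hs
  have hmem : ∀ r, r ∈ s ↔ ‖r‖ ≤ 1 / 4 := fun r => by rw [hs, mem_closedBall_zero_iff]
  have hmap : Set.MapsTo (fun r => L (f + r * r)) s s := by
    intro r hr
    rw [hmem] at hr ⊢
    have h1 := norm_mul_le r r
    have h2 := norm_add_le f (r * r)
    have h3 := hL (f + r * r)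
    nlinarith [norm_nonneg r]
  have hcon : ContractingWith (1 / 2) (hmap.restrict _ s s) := by
    refine ⟨by norm_num, LipschitzWith.of_dist_le_mul fun r r' => ?_⟩
    obtain ⟨r, hr⟩ := r
    obtain ⟨r', hr'⟩ := r'
    rw [hmem] at hr hr'
    simp only [Subtype.dist_eq, Set.MapsTo.val_restrict_apply, dist_eq_norm]
    rw [← map_sub]
    have h1 : f + r * r - (f + r' * r') = (r + r') * (r - r') := by ring
    rw [h1]
    have h2 := norm_add_le r r'
    calc _ ≤ ‖(r + r') * (r - r')‖ := hL _
      _ ≤ ‖r + r'‖ * ‖r - r'‖ := norm_mul_le _ _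
      _ ≤ (1 / 2) * ‖r - r'‖ := by gcongr; linarith
      _ = _ := by norm_num
  obtain ⟨r, hr, hfix, -⟩ := ContractingWith.exists_fixedPoint'
    (Metric.isClosed_closedBall.isComplete) hmap hcon (x := 0) ((hmem 0).2 (by norm_num))
    (edist_ne_top _ _)
  exact ⟨r, (hmem r).1 hr, hfix.symm⟩

/-! ### The decaying solution of the unperturbed equation -/

/-- A square root of `i`. -/
noncomputable def sqrtI : ℂ := ((√2 / 2 : ℝ) : ℂ) * (1 + Complex.I)

theorem sqrtI_sq : sqrtI ^ 2 = Complex.I := by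
  have h : ((√2 / 2 : ℝ) : ℂ) ^ 2 = 1 / 2 := by
    rw [← Complex.ofReal_pow, div_pow, Real.sq_sqrt (by norm_num)]; norm_num
  rw [sqrtI, mul_pow, h, add_sq, Complex.I_sq]; ring

theorem half_le_sqrtI_re : 1 / 2 ≤ sqrtI.re := by
  have h : (1 : ℝ) ≤ √2 := by rw [Real.one_le_sqrt]; norm_num
  simp only [sqrtI, Complex.re_ofReal_mul, Complex.add_re, Complex.one_re, Complex.I_re]
  linarith

theorem norm_sqrtI : ‖sqrtI‖ = 1 := by
  have h : ‖sqrtI‖ ^ 2 = 1 := by rw [← norm_pow, sqrtI_sq, Complex.norm_I]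
  nlinarith [norm_nonneg sqrtI]

/-- The equation `m' = i y ^ β - m²` has a solution near `∞` that behaves like `-√i y ^ (β / 2)`. -/
theorem exists_riccati_near_infty {β : ℝ} (hβ : 0 ≤ β) :
    ∃ R : ℝ, 1 ≤ R ∧ ∃ m : ℝ → ℂ, Continuous m ∧ (∀ y, (m y).re ≤ -(1 / 4)) ∧
      (∃ M, ∀ y ≥ R, ‖m y‖ ≤ M * (1 + y ^ β)) ∧
      ∀ y > R, HasDerivAt m (Complex.I * ((y ^ β : ℝ) : ℂ) - m y ^ 2) y := by
  -- The WKB ansatz `g = -√i y ^ (β / 2) - β / (4y)` satisfies `g' + g² - i y ^ β = γ / y²`. The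
  -- choice of `R` makes this residual at most `1 / 16` for `y ≥ R`, and freezing `y` at `max y R`
  -- extends the problem to the whole line.
  set γ : ℝ := (β ^ 2 + 4 * β) / 16 with hγ
  have hγ0 : 0 ≤ γ := by positivity
  set R : ℝ := 1 + 16 * γ with hR
  have hR1 : 1 ≤ R := by linarith
  have hY : ∀ y : ℝ, 1 ≤ max y R := fun y => hR1.trans (le_max_right _ _)
  have hY0 : ∀ y : ℝ, max y R ≠ 0 := fun y => by have := hY y; positivity
  set g : ℝ → ℂ := fun y => -(sqrtI * ((max y R ^ (β / 2) : ℝ) : ℂ))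
    - ((β / (4 * max y R) : ℝ) : ℂ) with hg
  have hpow : Continuous fun y : ℝ => max y R ^ (β / 2) :=
    (continuous_id.max continuous_const).rpow_const fun y => Or.inr (by positivity)
  have hdiv : Continuous fun y : ℝ => β / (4 * max y R) :=
    continuous_const.div (by fun_prop) fun y => mul_ne_zero four_ne_zero (hY0 y)
  have hgc : Continuous g := by fun_prop
  have hpow1 : ∀ y : ℝ, 1 ≤ max y R ^ (β / 2) := fun y =>
    Real.one_le_rpow (hY y) (by positivity)
  have hgre : ∀ y, (g y).re ≤ -(1 / 2) := by
    intro y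
    have h1 : 0 ≤ β / (4 * max y R) := by have := hY y; positivity
    have h2 := half_le_sqrtI_re
    have h3 := hpow1 y
    simp only [hg, Complex.sub_re, Complex.neg_re, Complex.re_mul_ofReal, Complex.ofReal_re]
    nlinarith
  -- With `Re g ≤ -1/2` the operator has norm at most `1`. The exact solution is `g + r`, where `r'
  -- = -(γ / y² + r²) - 2 g r` on `y > R`.
  obtain ⟨L, hLn, hLd⟩ := exists_backward_operator hgc (by norm_num : (0 : ℝ) < 1 / 2) hgre
  have hfb : ∀ y : ℝ, ‖((γ / max y R ^ 2 : ℝ) : ℂ)‖ ≤ 1 / 16 := by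
    intro y
    rw [Complex.norm_real, Real.norm_of_nonneg (by positivity), div_le_iff₀ (by have := hY y; positivity)]
    have : R ≤ max y R := le_max_right _ _
    nlinarith
  have hfc : Continuous fun y : ℝ => ((γ / max y R ^ 2 : ℝ) : ℂ) :=
    Complex.continuous_ofReal.comp (continuous_const.div (by fun_prop) fun y => pow_ne_zero 2 (hY0 y))
  set f : ℝ →ᵇ ℂ := BoundedContinuousFunction.ofNormedAddCommGroup _ hfc _ hfb with hf
  obtain ⟨r, hr, hrfix⟩ := exists_quadratic_fixedPoint L (fun f => by simpa using hLn f) f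
    ((BoundedContinuousFunction.norm_le (by norm_num)).2 hfb)
  have hrb : ∀ y, ‖r y‖ ≤ 1 / 4 := fun y => (r.norm_coe_le_norm y).trans hr
  have hrd : ∀ y, HasDerivAt r (-(f y + r y ^ 2) - 2 * g y * r y) y := by
    intro y
    have h := hLd (f + r * r) y
    rw [← hrfix] at h
    refine h.congr_deriv ?_
    simp [sq]
  refine ⟨R, hR1, fun y => g y + r y, hgc.add r.continuous, fun y => ?_, ⟨1 + β, fun y hy => ?_⟩,
    fun y hy => ?_⟩
  · have h1 := hgre y
    have h2 := (Complex.re_le_norm (r y)).trans (hrb y)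
    simp only [Complex.add_re]
    linarith
  · have hmax : max y R = y := max_eq_left hy
    have hy1 : 1 ≤ y := hR1.trans hy
    have h1 : ‖g y‖ ≤ y ^ (β / 2) + β / 4 := by
      simp only [hg, hmax]
      refine (norm_sub_le _ _).trans ?_
      rw [norm_neg, norm_mul, norm_sqrtI, Complex.norm_real, Complex.norm_real,
        Real.norm_of_nonneg (by positivity), Real.norm_of_nonneg (by positivity), one_mul]
      gcongr
      linarith
    have h2 : y ^ (β / 2) ≤ y ^ β := Real.rpow_le_rpow_of_exponent_le hy1 (by linarith)
    have h3 := norm_add_le (g y) (r y)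
    have h4 := hrb y
    have h5 : 0 ≤ y ^ β := by positivity
    nlinarith
  · have hy0 : 0 < y := by linarith
    have hmax : max y R = y := max_eq_left hy.le
    have hev : (fun x : ℝ => max x R) =ᶠ[𝓝 y] id := by
      filter_upwards [lt_mem_nhds hy] with x hx using max_eq_left hx.le
    have hp : HasDerivAt (fun x : ℝ => max x R ^ (β / 2)) (β / 2 * y ^ (β / 2 - 1)) y := by
      refine (Real.hasDerivAt_rpow_const (Or.inl hy0.ne')).congr_of_eventuallyEq ?_
      filter_upwards [hev] with x hx
      rw [hx]; rfl
    have hq : HasDerivAt (fun x : ℝ => β / (4 * max x R)) (-(β / (4 * y ^ 2))) y := by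
      have h := ((hasDerivAt_inv hy0.ne').const_mul (β / 4))
      refine (h.congr_of_eventuallyEq ?_).congr_deriv (by field_simp)
      filter_upwards [hev] with x hx
      rw [hx]; simp only [id]; rw [div_mul_eq_div_div, div_eq_mul_inv]
    have hgd : HasDerivAt g (-(sqrtI * ((β / 2 * y ^ (β / 2 - 1) : ℝ) : ℂ))
        - ((-(β / (4 * y ^ 2)) : ℝ) : ℂ)) y :=
      ((hp.ofReal_comp.const_mul sqrtI).neg).sub hq.ofReal_comp
    refine (hgd.add (hrd y)).congr_deriv ?_
    have hfy : f y = ((γ / y ^ 2 : ℝ) : ℂ) := by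
      simp [hf, hmax]
    have hgy : g y = -(sqrtI * ((y ^ (β / 2) : ℝ) : ℂ)) - ((β / (4 * y) : ℝ) : ℂ) := by
      simp only [hg, hmax]
    have e1 : y ^ (β / 2 - 1) = y ^ (β / 2) / y := Real.rpow_sub_one hy0.ne' _
    have e2 : y ^ β = (y ^ (β / 2)) ^ 2 := by
      rw [← Real.rpow_natCast, ← Real.rpow_mul hy0.le]; norm_num
    beta_reduce
    rw [hfy, hgy, e1, e2, hγ]
    have hyC : (y : ℂ) ≠ 0 := by exact_mod_cast hy0.ne'
    generalize y ^ (β / 2) = p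
    push_cast
    rw [← sqrtI_sq]
    field_simp
    ring

/-- Backward solution of `W'' = i y ^ β W` from `R` to `0`. -/
theorem exists_linear_backward {β : ℝ} (hβ : 0 ≤ β) {R : ℝ} (hR : 0 ≤ R) (w₀ z₀ : ℂ) :
    ∃ W Z : ℝ → ℂ, Continuous W ∧ Continuous Z ∧ W R = w₀ ∧ Z R = z₀ ∧
      (∀ y ∈ Set.Icc 0 R, HasDerivAt W (Z y) y) ∧
      ∀ y ∈ Set.Icc 0 R, HasDerivAt Z (Complex.I * ((y ^ β : ℝ) : ℂ) * W y) y := by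
  -- Time is reversed, `t = R - y`; the two clamps keep the coefficient bounded by `R ^ β` for all
  -- `t`, so the field is globally Lipschitz.
  set b : ℝ → ℂ := fun t => Complex.I * ((max (R - max t 0) 0 ^ β : ℝ) : ℂ) with hb
  have hbc : Continuous b := by
    have : Continuous fun t : ℝ => max (R - max t 0) 0 ^ β :=
      Continuous.rpow_const (by fun_prop) fun _ => Or.inr hβ
    fun_prop
  have hbb : ∀ t, ‖b t‖ ≤ R ^ β := by
    intro t
    have h0 : 0 ≤ max (R - max t 0) 0 := le_max_right _ _
    rw [hb, norm_mul, Complex.norm_I, one_mul, Complex.norm_real, Real.norm_of_nonneg (by positivity)]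
    refine Real.rpow_le_rpow h0 (max_le ?_ hR) hβ
    linarith [le_max_right t 0]
  obtain ⟨u, huc, hu0, hud⟩ := exists_integralCurve_of_lipschitz
    (f := fun t (p : ℂ × ℂ) => (p.2, b t * p.1)) (by fun_prop) (M := 1 + R ^ β) (by positivity)
    (by
      intro t x y
      have h1 : 0 ≤ R ^ β := by positivity
      refine max_le ?_ ?_
      · have := norm_snd_le (x - y)
        simp only [Prod.fst_sub, ← Prod.snd_sub]
        nlinarith [norm_nonneg (x - y)]
      · have := norm_fst_le (x - y)
        simp only [Prod.snd_sub, ← mul_sub, ← Prod.fst_sub, norm_mul]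
        have := mul_le_mul (hbb t) this (norm_nonneg _) h1
        nlinarith [norm_nonneg (x - y)])
    (by simp) (w₀, -z₀)
  refine ⟨fun y => (u (R - y)).1, fun y => -(u (R - y)).2, by fun_prop, by fun_prop, by simp [hu0],
    by simp [hu0], fun y hy => ?_, fun y hy => ?_⟩
  · have h := (hud (R - y) (by linarith [hy.2])).scomp y ((hasDerivAt_id y).const_sub R)
    have h' := (ContinuousLinearMap.fst ℝ ℂ ℂ).hasFDerivAt.comp_hasDerivAt y h
    exact h'.congr_deriv (by simp)
  · have h := (hud (R - y) (by linarith [hy.2])).scomp y ((hasDerivAt_id y).const_sub R)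
    have h' := ((ContinuousLinearMap.snd ℝ ℂ ℂ).hasFDerivAt.comp_hasDerivAt y h).neg
    have e : b (R - y) = Complex.I * ((y ^ β : ℝ) : ℂ) := by
      simp only [hb]
      rw [max_eq_left (by linarith [hy.2] : 0 ≤ R - y), sub_sub_cancel, max_eq_left hy.1]
    simp only [e] at h'
    exact h'.congr_deriv (by simp)

/-- The decaying solution `w` of `w'' = i y ^ β w` on the half-line has no zero, and its logarithmic
derivative has a negative real part bounded away from zero. -/
theorem exists_riccati_solution {β : ℝ} (hβ : 0 ≤ β) :
    ∃ m : ℝ → ℂ, Continuous m ∧ (∃ c > 0, ∀ y, (m y).re ≤ -c) ∧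
      (∃ M, ∀ y ≥ 0, ‖m y‖ ≤ M * (1 + y ^ β)) ∧
      ∀ y > 0, HasDerivAt m (Complex.I * ((y ^ β : ℝ) : ℂ) - m y ^ 2) y := by
  obtain ⟨R₀, hR₀, m, hmc, hmre, ⟨M, hM⟩, hmd⟩ := exists_riccati_near_infty hβ
  -- A gluing point strictly beyond `R₀`, so that `m` satisfies its equation at `R` itself.
  set R := R₀ + 1 with hR
  have hR0 : 0 < R := by linarith
  obtain ⟨W, Z, hWc, hZc, hWR, hZR, hWd, hZd⟩ := exists_linear_backward hβ hR0.le 1 (m R)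
  -- The potential contributes `Re (i y ^ β |W|²) = 0`, so only `|Z|²` is left in the derivative.
  have hmono : MonotoneOn (fun y => (Z y * (starRingEnd ℂ) (W y)).re) (Set.Icc 0 R) := by
    have hd : ∀ y ∈ Set.Icc 0 R, HasDerivAt (fun y => (Z y * (starRingEnd ℂ) (W y)).re)
        (‖Z y‖ ^ 2) y := by
      intro y hy
      have h1 : HasDerivAt (fun y => (starRingEnd ℂ) (W y)) ((starRingEnd ℂ) (Z y)) y := (hWd y hy).star
      have h2 := Complex.reCLM.hasFDerivAt.comp_hasDerivAt y ((hZd y hy).mul h1)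
      refine h2.congr_deriv ?_
      rw [Complex.reCLM_apply, Complex.add_re, mul_assoc, Complex.mul_conj, Complex.mul_conj,
        mul_assoc, ← Complex.ofReal_mul, ← Complex.normSq_eq_norm_sq]
      simp
    refine monotoneOn_of_deriv_nonneg (convex_Icc 0 R)
      (fun y hy => (hd y hy).continuousAt.continuousWithinAt) (fun y hy => ?_) (fun y hy => ?_)
    · exact (hd y (interior_subset hy)).differentiableAt.differentiableWithinAt
    · rw [(hd y (interior_subset hy)).deriv]; positivity
  have hneg : ∀ y ∈ Set.Icc 0 R, (Z y * (starRingEnd ℂ) (W y)).re ≤ -(1 / 4) := by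
    intro y hy
    have h := hmono hy (Set.right_mem_Icc.2 hR0.le) hy.2
    simp only [hWR, hZR, map_one, mul_one] at h
    exact h.trans (hmre R)
  have hW0 : ∀ y ∈ Set.Icc 0 R, W y ≠ 0 := by
    intro y hy h
    have := hneg y hy
    rw [h] at this
    norm_num at this
  set m₁ : ℝ → ℂ := fun y => Z y / W y with hm₁
  have hm₁d : ∀ y ∈ Set.Icc 0 R, HasDerivAt m₁ (Complex.I * ((y ^ β : ℝ) : ℂ) - m₁ y ^ 2) y := by
    intro y hy
    refine ((hZd y hy).div (hWd y hy) (hW0 y hy)).congr_deriv ?_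
    have := hW0 y hy
    simp only [hm₁]
    field_simp
  have hclamp : ∀ y : ℝ, max 0 (min y R) ∈ Set.Icc 0 R := fun y =>
    ⟨le_max_left _ _, max_le hR0.le (min_le_right _ _)⟩
  have hclampc : Continuous fun y : ℝ => max 0 (min y R) := by fun_prop
  have hm₁c : Continuous fun y => m₁ (max 0 (min y R)) :=
    (hZc.comp hclampc).div (hWc.comp hclampc) fun y => hW0 _ (hclamp y)
  obtain ⟨B, hB⟩ := isCompact_Icc.exists_bound_of_continuousOn (s := Set.Icc 0 R)
    hWc.continuousOn
  have hB0 : 0 < B := (norm_pos_iff.2 (hW0 0 ⟨le_rfl, hR0.le⟩)).trans_le (hB 0 ⟨le_rfl, hR0.le⟩)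
  have hm₁re : ∀ y ∈ Set.Icc 0 R, (m₁ y).re ≤ -(1 / (4 * B ^ 2)) := by
    intro y hy
    have hn : 0 < Complex.normSq (W y) := Complex.normSq_pos.2 (hW0 y hy)
    have h1 : m₁ y = (Z y * (starRingEnd ℂ) (W y)) / (Complex.normSq (W y) : ℂ) := by
      rw [← Complex.mul_conj]
      have h2 := hW0 y hy
      have h3 : (starRingEnd ℂ) (W y) ≠ 0 := (map_ne_zero _).2 h2
      simp only [hm₁]
      field_simp
    have h4 : Complex.normSq (W y) ≤ B ^ 2 := by
      rw [Complex.normSq_eq_norm_sq]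
      exact pow_le_pow_left₀ (norm_nonneg _) (hB y hy) 2
    rw [h1, Complex.div_ofReal_re, div_le_iff₀ hn]
    refine (hneg y hy).trans ?_
    rw [neg_mul, neg_le_neg_iff, div_mul_eq_mul_div, div_le_iff₀ (by positivity)]
    linarith
  obtain ⟨M₁, hM₁⟩ := isCompact_Icc.exists_bound_of_continuousOn (s := Set.Icc 0 R)
    hm₁c.continuousOn
  refine ⟨fun y => if y ≤ R then m₁ (max 0 (min y R)) else m y, ?_,
    ⟨min (1 / (4 * B ^ 2)) (1 / 4), by positivity, fun y => ?_⟩,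
    ⟨max M₁ M, fun y hy => ?_⟩, fun y hy => ?_⟩
  · refine hm₁c.if_le hmc continuous_id continuous_const fun y hy => ?_
    rw [hy, min_self, max_eq_right hR0.le, hm₁]
    simp [hWR, hZR]
  · beta_reduce
    split_ifs with h
    · exact (hm₁re _ (hclamp y)).trans (neg_le_neg (min_le_left _ _))
    · exact (hmre y).trans (neg_le_neg (min_le_right _ _))
  · have hy1 : 0 ≤ y ^ β := by positivity
    beta_reduce
    split_ifs with h
    · have h1 := hM₁ y ⟨hy, h⟩
      have h2 : 0 ≤ M₁ := (norm_nonneg _).trans h1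
      exact h1.trans ((le_max_left M₁ M).trans
        (le_mul_of_one_le_right (h2.trans (le_max_left _ _)) (by linarith)))
    · refine (hM y (by linarith)).trans ?_
      gcongr
      exact le_max_right _ _
  · have hin : ∀ x ∈ Set.Ioc 0 R, (if x ≤ R then m₁ (max 0 (min x R)) else m x) = m₁ x := by
      intro x hx
      rw [if_pos hx.2, min_eq_left hx.2, max_eq_right hx.1.le]
    have hout : ∀ x ≥ R, (if x ≤ R then m₁ (max 0 (min x R)) else m x) = m x := by
      intro x hx
      rcases hx.eq_or_lt with h | h
      · rw [← h, hin R ⟨hR0, le_rfl⟩, hm₁]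
        simp [hWR, hZR]
      · rw [if_neg (not_le.2 h)]
    -- At `R` both pieces have the same value and satisfy the same equation, so the one-sided
    -- derivatives coincide.
    have hleft : y ≤ R → HasDerivWithinAt (fun x => if x ≤ R then m₁ (max 0 (min x R)) else m x)
        (Complex.I * ((y ^ β : ℝ) : ℂ)
          - (if y ≤ R then m₁ (max 0 (min y R)) else m y) ^ 2) (Set.Iic R) y := by
      intro h
      rw [hin y ⟨hy, h⟩]
      refine (hm₁d y ⟨hy.le, h⟩).hasDerivWithinAt.congr_of_eventuallyEq ?_ (hin y ⟨hy, h⟩)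
      filter_upwards [self_mem_nhdsWithin, mem_nhdsWithin_of_mem_nhds (lt_mem_nhds hy)]
        with x hx hx0 using hin x ⟨hx0, hx⟩
    have hright : R ≤ y → HasDerivWithinAt (fun x => if x ≤ R then m₁ (max 0 (min x R)) else m x)
        (Complex.I * ((y ^ β : ℝ) : ℂ)
          - (if y ≤ R then m₁ (max 0 (min y R)) else m y) ^ 2) (Set.Ici R) y := by
      intro h
      rw [hout y h]
      refine (hmd y (by linarith)).hasDerivWithinAt.congr (fun x hx => hout x hx) (hout y h)
    rcases lt_trichotomy y R with h | h | h
    · exact (hleft h.le).hasDerivAt (Iic_mem_nhds h)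
    · have h1 := (hleft h.le)
      have h2 := (hright h.ge)
      have := h1.union h2
      rw [Set.Iic_union_Ici] at this
      exact this.hasDerivAt univ_mem
    · exact (hright h.le).hasDerivAt (Ici_mem_nhds h)

/-! ### Matching by the inverse function theorem -/

/-- The matching function: its zeros `(ε, δ, s)` (after projecting away the first component) give
the logarithmic derivatives `m₀ + s` that match the oscillation with wave number `κ₀ + δ / a`. -/
noncomputable def matchingMap (L : (ℝ →ᵇ ℂ) →L[ℂ] (ℝ →ᵇ ℂ)) (κ₀ b m₀ : ℂ)
    (x : ℂ × ℂ × (ℝ →ᵇ ℂ)) : ℂ × ℂ × (ℝ →ᵇ ℂ) :=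
  (x.1, (κ₀ + b * x.2.1) * x.1 * Complex.cos x.2.1 - Complex.sin x.2.1 * (m₀ + x.2.2 0),
    x.2.2 - L ((x.1 * (κ₀ + b * x.2.1)) ^ 2 • (1 : ℝ →ᵇ ℂ) + x.2.2 * x.2.2))

/-- The derivative of `matchingMap` at the origin. -/
noncomputable def matchingDeriv (κ₀ : ℂ) {m₀ : ℂ} (hm₀ : m₀ ≠ 0) :
    (ℂ × ℂ × (ℝ →ᵇ ℂ)) ≃L[ℂ] (ℂ × ℂ × (ℝ →ᵇ ℂ)) :=
  let p₁ := ContinuousLinearMap.fst ℂ ℂ (ℂ × (ℝ →ᵇ ℂ))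
  let p := ContinuousLinearMap.snd ℂ ℂ (ℂ × (ℝ →ᵇ ℂ))
  let p₂ := (ContinuousLinearMap.fst ℂ ℂ (ℝ →ᵇ ℂ)).comp p
  let p₃ := (ContinuousLinearMap.snd ℂ ℂ (ℝ →ᵇ ℂ)).comp p
  ContinuousLinearEquiv.equivOfInverse (p₁.prod ((κ₀ • p₁ - m₀ • p₂).prod p₃))
    (p₁.prod ((m₀⁻¹ • (κ₀ • p₁ - p₂)).prod p₃))
    (fun x => by
      refine Prod.ext rfl (Prod.ext ?_ rfl)
      simp only [p₁, p₂, p₃, p, ContinuousLinearMap.prod_apply, smul_apply,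
        sub_apply, ContinuousLinearMap.comp_apply,
        ContinuousLinearMap.coe_fst', ContinuousLinearMap.coe_snd', smul_eq_mul]
      field_simp
      ring)
    (fun x => by
      refine Prod.ext rfl (Prod.ext ?_ rfl)
      simp only [p₁, p₂, p₃, p, ContinuousLinearMap.prod_apply, smul_apply,
        sub_apply, ContinuousLinearMap.comp_apply,
        ContinuousLinearMap.coe_fst', ContinuousLinearMap.coe_snd', smul_eq_mul]
      field_simp
      ring)

/-- The terms `(ε κ)²` and `s²` are quadratic at the origin, and so are `δ s(0)` and `ε δ`. Only `κ₀
ε - m₀ δ` and `s` survive, which is a triangular map. -/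
theorem hasStrictFDerivAt_matchingMap (L : (ℝ →ᵇ ℂ) →L[ℂ] (ℝ →ᵇ ℂ)) (κ₀ b : ℂ) {m₀ : ℂ}
    (hm₀ : m₀ ≠ 0) : HasStrictFDerivAt (matchingMap L κ₀ b m₀)
      (matchingDeriv κ₀ hm₀ : (ℂ × ℂ × (ℝ →ᵇ ℂ)) →L[ℂ] (ℂ × ℂ × (ℝ →ᵇ ℂ))) 0 := by
  set p₁ := ContinuousLinearMap.fst ℂ ℂ (ℂ × (ℝ →ᵇ ℂ))
  set p := ContinuousLinearMap.snd ℂ ℂ (ℂ × (ℝ →ᵇ ℂ))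
  set p₂ := (ContinuousLinearMap.fst ℂ ℂ (ℝ →ᵇ ℂ)).comp p
  set p₃ := (ContinuousLinearMap.snd ℂ ℂ (ℝ →ᵇ ℂ)).comp p
  have h₁ : HasStrictFDerivAt (fun x : ℂ × ℂ × (ℝ →ᵇ ℂ) => x.1) p₁ 0 := p₁.hasStrictFDerivAt
  have h₂ : HasStrictFDerivAt (fun x : ℂ × ℂ × (ℝ →ᵇ ℂ) => x.2.1) p₂ 0 := p₂.hasStrictFDerivAt
  have h₃ : HasStrictFDerivAt (fun x : ℂ × ℂ × (ℝ →ᵇ ℂ) => x.2.2) p₃ 0 := p₃.hasStrictFDerivAt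
  have h₄ : HasStrictFDerivAt (fun x : ℂ × ℂ × (ℝ →ᵇ ℂ) => x.2.2 0)
      ((BoundedContinuousFunction.evalCLM ℂ (0 : ℝ)).comp p₃) 0 :=
    ((BoundedContinuousFunction.evalCLM ℂ (0 : ℝ)).comp p₃).hasStrictFDerivAt
  have hκ := (h₂.const_mul b).const_add κ₀
  have hG := ((hκ.mul h₁).mul h₂.ccos).sub (h₂.csin.mul (h₄.const_add m₀))
  have hS := h₃.sub (L.hasStrictFDerivAt.comp 0
    ((((h₁.mul hκ).pow 2).smul_const (1 : ℝ →ᵇ ℂ)).add (h₃.mul h₃)))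
  refine (h₁.prodMk (hG.prodMk hS)).congr_fderiv ?_
  refine ContinuousLinearMap.ext fun x => Prod.ext rfl (Prod.ext ?_ ?_)
  · simp [matchingDeriv, p₁, p₂, p₃, p, ContinuousLinearEquiv.equivOfInverse]
  · simp [matchingDeriv, p₁, p₂, p₃, p, ContinuousLinearEquiv.equivOfInverse]

/-- Solutions of the matching condition, by the inverse function theorem. -/
theorem exists_matching {β a : ℝ} (hβ : 0 ≤ β) (κ₀ : ℂ) :
    ∃ ε₀ > (0 : ℝ), ∃ K > (0 : ℝ), ∀ ε ∈ Set.Ioo (0 : ℝ) ε₀, ∃ (δ : ℂ) (m : ℝ → ℂ),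
      ‖δ‖ ≤ K * ε ∧ Continuous m ∧ (∃ c > 0, ∀ y, (m y).re ≤ -c) ∧
      (∃ M, ∀ y ≥ 0, ‖m y‖ ≤ M * (1 + y ^ β)) ∧
      (∀ y > 0, HasDerivAt m
        (Complex.I * ((y ^ β : ℝ) : ℂ) - (ε * (κ₀ + δ / a)) ^ 2 - m y ^ 2) y) ∧
      (κ₀ + δ / a) * ε * Complex.cos δ = Complex.sin δ * m 0 := by
  obtain ⟨g, hgc, ⟨c, hc0, hgre⟩, ⟨M, hM⟩, hgd⟩ := exists_riccati_solution hβ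
  obtain ⟨L, hLn, hLd⟩ := exists_backward_operator hgc hc0 hgre
  have hg0 : g 0 ≠ 0 := by
    intro h
    have := hgre 0
    rw [h, Complex.zero_re] at this
    linarith
  set Φ := matchingMap L κ₀ ((a : ℂ)⁻¹) (g 0) with hΦ
  have hΦ0 : Φ 0 = 0 := by
    refine Prod.ext ?_ (Prod.ext ?_ ?_) <;> simp [hΦ, matchingMap]
  have hd : HasStrictFDerivAt Φ
      (matchingDeriv κ₀ hg0 : (ℂ × ℂ × (ℝ →ᵇ ℂ)) →L[ℂ] (ℂ × ℂ × (ℝ →ᵇ ℂ))) 0 :=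
    hasStrictFDerivAt_matchingMap L κ₀ ((a : ℂ)⁻¹) hg0
  set Ψ := hd.localInverse with hΨ
  have hright : ∀ᶠ z in 𝓝 (0 : ℂ × ℂ × (ℝ →ᵇ ℂ)), Φ (Ψ z) = z := by
    have := hd.eventually_right_inverse
    rwa [hΦ0] at this
  have hΨ0 : Ψ 0 = 0 := by
    have := hd.localInverse_apply_image
    rwa [hΦ0] at this
  -- Differentiability of the inverse at `0` provides the linear bound that makes `δ` and `s` of
  -- order `ε`.
  have hbig : Ψ =O[𝓝 0] (fun z => z) := by
    have h := hd.to_localInverse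
    rw [hΦ0] at h
    have := h.hasFDerivAt.isBigO_sub
    rw [← hΨ] at this
    simpa [hΨ0] using this
  obtain ⟨K, hK0, hK⟩ := hbig.exists_pos
  have hev := (hright.and hK.bound)
  obtain ⟨ε₁, hε₁, hball⟩ := Metric.eventually_nhds_iff_ball.1 hev
  -- The bound `c / (2K)` forces `‖s‖ ≤ c / 2`, so `g + s` keeps real part at most `-c / 2`.
  refine ⟨min ε₁ (c / (2 * K)), by positivity, K, hK0, fun ε hε => ?_⟩
  set z : ℂ × ℂ × (ℝ →ᵇ ℂ) := ((ε : ℂ), 0, 0) with hz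
  have hzn : ‖z‖ = ε := by
    simp [hz, Prod.norm_def, abs_of_pos hε.1, hε.1.le]
  obtain ⟨h1, h2⟩ := hball z (by
    rw [mem_ball_zero_iff, hzn]; exact hε.2.trans_le (min_le_left _ _))
  rw [hzn] at h2
  have e1 : (Ψ z).1 = ε := congrArg (fun q => q.1) h1
  have e2 := congrArg (fun q => q.2.1) h1
  have e3 := congrArg (fun q => q.2.2) h1
  simp only [hΦ, matchingMap, hz] at e2 e3
  rw [← hz, e1] at e2 e3
  set δ := (Ψ z).2.1 with hδ
  set s := (Ψ z).2.2 with hs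
  have hδn : ‖δ‖ ≤ K * ε := ((norm_fst_le _).trans (norm_snd_le _)).trans h2
  have hsn : ‖s‖ ≤ c / 2 := by
    refine (((norm_snd_le _).trans (norm_snd_le _)).trans h2).trans ?_
    have := hε.2.trans_le (min_le_right _ _)
    rw [lt_div_iff₀ (by positivity)] at this
    linarith
  have hsy : ∀ y, ‖s y‖ ≤ c / 2 := fun y => (s.norm_coe_le_norm y).trans hsn
  refine ⟨δ, fun y => g y + s y, hδn, hgc.add s.continuous, ⟨c / 2, by positivity, fun y => ?_⟩,
    ⟨M + c / 2, fun y hy => ?_⟩, fun y hy => ?_, ?_⟩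
  · have h3 := hgre y
    have h4 := (Complex.re_le_norm (s y)).trans (hsy y)
    simp only [Complex.add_re]
    linarith
  · have h3 := hM y hy
    have h4 := hsy y
    have h5 := norm_add_le (g y) (s y)
    have h6 : 0 ≤ y ^ β := Real.rpow_nonneg hy _
    nlinarith
  · have h3 := hLd ((ε * (κ₀ + (a : ℂ)⁻¹ * δ)) ^ 2 • (1 : ℝ →ᵇ ℂ) + s * s) y
    rw [← sub_eq_zero.1 e3] at h3
    refine ((hgd y hy).add h3).congr_deriv ?_
    simp only [BoundedContinuousFunction.coe_add, BoundedContinuousFunction.coe_smul,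
      BoundedContinuousFunction.coe_mul, BoundedContinuousFunction.coe_one, Pi.add_apply,
      Pi.mul_apply, Pi.one_apply, smul_eq_mul]
    ring
  · rw [div_eq_inv_mul]
    exact sub_eq_zero.1 e2

/-! ### Weak derivatives -/

/-- Integration by parts on the line against a compactly supported function, where the derivative
of the continuous function `f` may fail to exist on a countable set. -/
theorem integral_mul_deriv_eq_neg_of_hasDerivAt_off_countable {f g ψ ψ' : ℝ → ℂ} {s : Set ℝ}
    (hs : s.Countable) (hf : Continuous f) (hg : LocallyIntegrable g)
    (hd : ∀ x ∉ s, HasDerivAt f (g x) x) (hψ : ∀ x, HasDerivAt ψ (ψ' x) x)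
    (hψ' : Continuous ψ') (hc : HasCompactSupport ψ) :
    ∫ x, f x * ψ' x = -∫ x, g x * ψ x := by
  have hψc : Continuous ψ := continuous_iff_continuousAt.2 fun x => (hψ x).continuousAt
  have hψ'eq : ψ' = deriv ψ := funext fun x => (hψ x).deriv.symm
  have hc' : HasCompactSupport ψ' := hψ'eq ▸ hc.deriv
  have hi₁ : Integrable fun x => f x * ψ' x :=
    (hf.mul hψ').integrable_of_hasCompactSupport hc'.mul_left
  have hi₂ : Integrable fun x => g x * ψ x := by
    have := hg.integrable_smul_left_of_hasCompactSupport hψc hc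
    simpa only [smul_eq_mul, mul_comm] using this
  obtain ⟨N, hN⟩ := hc.isCompact.isBounded.subset_closedBall (0 : ℝ)
  have hzero : ∀ x, N + 1 ≤ |x| → ψ x = 0 := by
    intro x hx
    refine image_eq_zero_of_notMem_tsupport fun h => ?_
    have := hN h
    rw [mem_closedBall_zero_iff, Real.norm_eq_abs] at this
    linarith
  have hzero' : ∀ x, N + 1 ≤ |x| → ψ' x = 0 := by
    intro x hx
    refine image_eq_zero_of_notMem_tsupport fun h => ?_
    have := hN (tsupport_deriv_subset (f := ψ) (hψ'eq ▸ h))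
    rw [mem_closedBall_zero_iff, Real.norm_eq_abs] at this
    linarith
  set B : ℝ := |N| + 1 with hB
  have hB0 : 0 < B := by positivity
  have hBN : N + 1 ≤ B := by have := le_abs_self N; linarith
  have hsum : ∫ x, (g x * ψ x + f x * ψ' x) = 0 := by
    rw [← setIntegral_eq_integral_of_forall_compl_eq_zero (s := Set.Ioc (-B) B),
      ← intervalIntegral.integral_of_le (by linarith),
      integral_eq_of_hasDerivAt_off_countable (fun x => f x * ψ x) _ hs
        (hf.mul hψc).continuousOn (fun x hx => (hd x hx.2).mul (hψ x))
        (hi₂.add hi₁).intervalIntegrable]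
    · rw [hzero B (by rw [abs_of_pos hB0]; exact hBN),
        hzero (-B) (by rw [abs_neg, abs_of_pos hB0]; exact hBN)]
      simp
    · intro x hx
      have hx' : N + 1 ≤ |x| := by
        by_contra h
        have h2 := abs_lt.1 (not_le.1 h)
        exact hx ⟨by linarith, by linarith⟩
      rw [hzero x hx', hzero' x hx']
      simp
  rw [integral_add hi₂ hi₁] at hsum
  exact eq_neg_of_add_eq_zero_right hsum

theorem TestFunction.hasDerivAt (φ : 𝓓(halfLine, ℂ)) (x : ℝ) : HasDerivAt φ (deriv φ x) x :=
  (φ.contDiff.differentiable (by simp) x).hasDerivAt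

theorem TestFunction.continuous_deriv (φ : 𝓓(halfLine, ℂ)) : Continuous (deriv φ) :=
  φ.contDiff.continuous_deriv (by simp)

theorem hasWeakDeriv_of_hasDerivAt_off_countable {f g : ℝ → ℂ} {s : Set ℝ} (hs : s.Countable)
    (hf : Continuous f) (hg : LocallyIntegrable g) (hd : ∀ x ∉ s, HasDerivAt f (g x) x) :
    HasWeakDeriv f g := by
  refine ⟨hf.locallyIntegrable.locallyIntegrableOn _, hg.locallyIntegrableOn _, fun φ => ?_⟩
  have hout : ∀ x, x ∉ Set.Ioi (0 : ℝ) → x ∉ tsupport φ := fun x hx h =>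
    hx (φ.tsupport_subset h)
  rw [setIntegral_eq_integral_of_forall_compl_eq_zero (fun x hx => ?_),
    setIntegral_eq_integral_of_forall_compl_eq_zero (fun x hx => ?_)]
  · exact integral_mul_deriv_eq_neg_of_hasDerivAt_off_countable hs hf hg hd φ.hasDerivAt
      φ.continuous_deriv φ.hasCompactSupport
  · rw [image_eq_zero_of_notMem_tsupport (hout x hx), mul_zero]
  · rw [image_eq_zero_of_notMem_tsupport fun h => hout x hx (tsupport_deriv_subset h), mul_zero]

/-! ### Exponential decay and square integrability -/

/-- Exponential decay on the half-line. -/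
def ExpDecay (f : ℝ → ℂ) : Prop :=
  ∃ C d : ℝ, 0 < d ∧ ∀ x > 0, ‖f x‖ ≤ C * Real.exp (-d * x)

theorem integrable_exp_sq (C : ℝ) {d : ℝ} (hd : 0 < d) :
    Integrable (fun x => (C * Real.exp (-d * x)) ^ 2) halfLineMeasure := by
  have h := (integrableOn_exp_mul_Ioi (a := -(2 * d)) (by linarith) 0).const_mul (C ^ 2)
  refine h.congr (ae_of_all _ fun x => ?_)
  simp only [mul_pow]
  rw [← Real.exp_nat_mul]
  congr 2
  push_cast
  ring

theorem memLp_two_of_expDecay {f : ℝ → ℂ} (hm : AEStronglyMeasurable f halfLineMeasure)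
    (hf : ExpDecay f) : MemLp f 2 halfLineMeasure := by
  obtain ⟨C, d, hd, h⟩ := hf
  have hE : MemLp (fun x => C * Real.exp (-d * x)) 2 halfLineMeasure :=
    (memLp_two_iff_integrable_sq (Continuous.aestronglyMeasurable (by fun_prop))).2
      (integrable_exp_sq C hd)
  exact hE.mono' hm ((ae_restrict_iff' measurableSet_Ioi).2 (ae_of_all _ h))

theorem memH2_of_expDecay {v v₁ v₂ : ℝ → ℂ} (h₁ : HasWeakDeriv v v₁) (h₂ : HasWeakDeriv v₁ v₂)
    (hv : ExpDecay v) (hv₁ : ExpDecay v₁) (hv₂ : ExpDecay v₂) : MemH2 v :=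
  ⟨memLp_two_of_expDecay h₁.1.aestronglyMeasurable hv, v₁, v₂, h₁, h₂,
    memLp_two_of_expDecay h₁.2.1.aestronglyMeasurable hv₁,
    memLp_two_of_expDecay h₂.2.1.aestronglyMeasurable hv₂⟩

/-- Dominated convergence to zero in `L²(0, ∞)`. -/
theorem tendsto_eLpNorm_two_of_dominated {F : ℕ → ℝ → ℂ} {C d : ℝ} (hd : 0 < d)
    (hm : ∀ n, AEStronglyMeasurable (F n) halfLineMeasure)
    (hb : ∀ n, ∀ x > 0, ‖F n x‖ ≤ C * Real.exp (-d * x))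
    (hlim : ∀ x > 0, Tendsto (fun n => F n x) atTop (𝓝 0)) :
    Tendsto (fun n => eLpNorm (F n) 2 halfLineMeasure) atTop (𝓝 0) := by
  have hint : Tendsto (fun n => ∫⁻ x in Set.Ioi (0 : ℝ), ENNReal.ofReal (‖F n x‖ ^ 2)) atTop
      (𝓝 (∫⁻ _ in Set.Ioi (0 : ℝ), 0)) := by
    refine tendsto_lintegral_of_dominated_convergence'
      (fun x => ENNReal.ofReal ((C * Real.exp (-d * x)) ^ 2))
      (fun n => ((hm n).norm.aemeasurable.pow_const 2).ennreal_ofReal) (fun n => ?_)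
      (integrable_exp_sq C hd).lintegral_lt_top.ne ?_
    · refine (ae_restrict_iff' measurableSet_Ioi).2 (ae_of_all _ fun x hx => ?_)
      exact ENNReal.ofReal_le_ofReal (pow_le_pow_left₀ (norm_nonneg _) (hb n x hx) 2)
    · refine (ae_restrict_iff' measurableSet_Ioi).2 (ae_of_all _ fun x hx => ?_)
      have := ((hlim x hx).norm.pow 2)
      simpa using ENNReal.tendsto_ofReal this
  have heq : ∀ n, eLpNorm (F n) 2 halfLineMeasure
      = (∫⁻ x in Set.Ioi (0 : ℝ), ENNReal.ofReal (‖F n x‖ ^ 2)) ^ (1 / 2 : ℝ) := by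
    intro n
    rw [eLpNorm_eq_lintegral_rpow_enorm_toReal (by norm_num) (by norm_num)]
    simp only [ENNReal.toReal_ofNat]
    congr 1
    refine lintegral_congr fun x => ?_
    rw [ENNReal.ofReal_pow (norm_nonneg _), ofReal_norm]
    exact_mod_cast ENNReal.rpow_natCast _ 2
  simp_rw [heq]
  have := hint.ennrpow_const (1 / 2 : ℝ)
  simpa using this

/-! ### Mollification -/

section Mollifier

open scoped Convolution

/-- A sequence of mollifiers. -/
noncomputable def mollifier (n : ℕ) : ContDiffBump (0 : ℝ) where
  rIn := 1 / (2 * ((n : ℝ) + 1))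
  rOut := 1 / ((n : ℝ) + 1)
  rIn_pos := by positivity
  rIn_lt_rOut := by
    apply one_div_lt_one_div_of_lt (by positivity)
    have : (0 : ℝ) ≤ n := n.cast_nonneg
    linarith

/-- Mollification. -/
noncomputable def mollify (n : ℕ) (V : ℝ → ℂ) : ℝ → ℂ :=
  (mollifier n).normed volume ⋆[ContinuousLinearMap.lsmul ℝ ℝ, volume] V

theorem contDiff_mollify (n : ℕ) {V : ℝ → ℂ} (hV : LocallyIntegrable V) {k : ℕ∞} :
    ContDiff ℝ k (mollify n V) :=
  (mollifier n).hasCompactSupport_normed.contDiff_convolution_left _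
    (mollifier n).contDiff_normed hV

/-- The derivative falls on the kernel first; integration by parts, which tolerates the exceptional
set, then moves it onto `V`. -/
theorem hasDerivAt_mollify (n : ℕ) {V V₁ : ℝ → ℂ} {s : Set ℝ} (hs : s.Countable)
    (hV : Continuous V) (hV₁ : LocallyIntegrable V₁) (hd : ∀ x ∉ s, HasDerivAt V (V₁ x) x)
    (x : ℝ) : HasDerivAt (mollify n V) (mollify n V₁ x) x := by
  set ρ := (mollifier n).normed (volume : Measure ℝ) with hρ
  have hρd : ContDiff ℝ 1 ρ := (mollifier n).contDiff_normed
  have h := (mollifier n).hasCompactSupport_normed.hasDerivAt_convolution_left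
    (ContinuousLinearMap.lsmul ℝ ℝ) hρd (hV.locallyIntegrable (μ := volume)) x
  refine h.congr_deriv ?_
  rw [mollify, convolution_eq_swap, convolution_eq_swap]
  have hψ : ∀ t, HasDerivAt (fun t => ((ρ (x - t) : ℝ) : ℂ)) (-((deriv ρ (x - t) : ℝ) : ℂ)) t := by
    intro t
    have h1 : HasDerivAt ρ (deriv ρ (x - t)) (x - t) :=
      (hρd.differentiable (by norm_num) _).hasDerivAt
    have h2 := (h1.comp t ((hasDerivAt_id t).const_sub x)).ofReal_comp
    simpa using h2
  have hψ' : Continuous fun t => -((deriv ρ (x - t) : ℝ) : ℂ) := by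
    have := hρd.continuous_deriv (by norm_num)
    fun_prop
  have hcs : HasCompactSupport fun t => ((ρ (x - t) : ℝ) : ℂ) := by
    have h1 : HasCompactSupport fun t => ρ (x - t) :=
      (mollifier n).hasCompactSupport_normed.comp_homeomorph (Homeomorph.subLeft x)
    exact h1.comp_left (g := fun r : ℝ => (r : ℂ)) (by simp)
  have hibp := integral_mul_deriv_eq_neg_of_hasDerivAt_off_countable hs hV hV₁ hd hψ hψ' hcs
  simp only [mul_neg, integral_neg, neg_inj] at hibp
  simp only [ContinuousLinearMap.lsmul_apply, Complex.real_smul]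
  simpa only [mul_comm] using hibp

/-- The kernel has mass one and radius at most `1`, so averaging costs at most a factor `exp d`,
uniformly in `n`. -/
theorem norm_mollify_le (n : ℕ) {V : ℝ → ℂ} {C d : ℝ} (hd : 0 ≤ d)
    (hV : ∀ x, ‖V x‖ ≤ C * Real.exp (-d * x)) (x : ℝ) :
    ‖mollify n V x‖ ≤ C * Real.exp d * Real.exp (-d * x) := by
  set ρ := (mollifier n).normed (volume : Measure ℝ) with hρ
  have hC : 0 ≤ C := by simpa using (norm_nonneg _).trans (hV 0)
  have hint : Integrable ρ := (mollifier n).integrable_normed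
  rw [mollify, convolution_def]
  have hle : ∀ t, ‖ContinuousLinearMap.lsmul ℝ ℝ (ρ t) (V (x - t))‖
      ≤ ρ t * (C * Real.exp d * Real.exp (-d * x)) := by
    intro t
    rw [ContinuousLinearMap.lsmul_apply, norm_smul,
      Real.norm_of_nonneg ((mollifier n).nonneg_normed t)]
    by_cases ht : t ∈ Metric.ball (0 : ℝ) (mollifier n).rOut
    · refine mul_le_mul_of_nonneg_left ((hV _).trans ?_) ((mollifier n).nonneg_normed t)
      rw [mul_assoc, ← Real.exp_add]
      refine mul_le_mul_of_nonneg_left (Real.exp_le_exp.2 ?_) hC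
      have h1 : (mollifier n).rOut ≤ 1 := by
        show 1 / ((n : ℝ) + 1) ≤ 1
        rw [div_le_one (by positivity)]
        have : (0 : ℝ) ≤ n := n.cast_nonneg
        linarith
      rw [mem_ball_zero_iff, Real.norm_eq_abs] at ht
      have := (le_abs_self t).trans (ht.le.trans h1)
      nlinarith
    · have h0 : ρ t = 0 := by
        rw [← Function.notMem_support, hρ, (mollifier n).support_normed_eq]
        exact ht
      change ρ t * _ ≤ _
      rw [h0, zero_mul, zero_mul]
  refine (norm_integral_le_of_norm_le (hint.mul_const _) (ae_of_all _ hle)).trans ?_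
  rw [integral_mul_const, hρ, (mollifier n).integral_normed, one_mul]

theorem mollify_eq_zero (n : ℕ) {V : ℝ → ℂ} (hV : ∀ x ≤ 0, V x = 0) {x : ℝ}
    (hx : x ≤ -(1 / ((n : ℝ) + 1))) : mollify n V x = 0 := by
  rw [mollify, convolution_def]
  refine integral_eq_zero_of_ae (ae_of_all _ fun t => ?_)
  by_cases ht : t ∈ Metric.ball (0 : ℝ) (mollifier n).rOut
  · rw [mem_ball_zero_iff, Real.norm_eq_abs] at ht
    have h1 : |t| < 1 / ((n : ℝ) + 1) := ht
    have h2 := neg_abs_le t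
    simp [hV (x - t) (by linarith)]
  · have h0 : (mollifier n).normed volume t = 0 := by
      rw [← Function.notMem_support, (mollifier n).support_normed_eq]
      exact ht
    simp [h0]

theorem tendsto_mollify {V : ℝ → ℂ} (hVm : AEStronglyMeasurable V) {x : ℝ}
    (hV : ContinuousAt V x) {k : ℕ → ℝ} (hk : Tendsto k atTop (𝓝 x)) :
    Tendsto (fun n => mollify n V (k n)) atTop (𝓝 (V x)) := by
  refine ContDiffBump.convolution_tendsto_right (φ := mollifier) (g := fun _ => V) ?_
    (Eventually.of_forall fun _ => hVm) ?_ hk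
  · exact tendsto_one_div_add_atTop_nhds_zero_nat
  · exact hV.tendsto.comp tendsto_snd

end Mollifier

/-! ### Approximation by test functions in `H¹` -/

theorem ExpDecay.exists_common_bound {f g : ℝ → ℂ} (hf : ExpDecay f) (hg : ExpDecay g) :
    ∃ C d : ℝ, 0 ≤ C ∧ 0 < d ∧ (∀ x > 0, ‖f x‖ ≤ C * Real.exp (-d * x)) ∧
      ∀ x > 0, ‖g x‖ ≤ C * Real.exp (-d * x) := by
  obtain ⟨C₁, d₁, hd₁, h₁⟩ := hf
  obtain ⟨C₂, d₂, hd₂, h₂⟩ := hg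
  refine ⟨max |C₁| |C₂|, min d₁ d₂, by positivity, lt_min hd₁ hd₂, fun x hx => ?_, fun x hx => ?_⟩
  · refine (h₁ x hx).trans ?_
    gcongr
    · exact (le_abs_self _).trans (le_max_left _ _)
    · exact min_le_left _ _
  · refine (h₂ x hx).trans ?_
    gcongr
    · exact (le_abs_self _).trans (le_max_right _ _)
    · exact min_le_right _ _

/-- A smooth cutoff function, equal to one near the origin. -/
noncomputable def cutoff : ContDiffBump (0 : ℝ) := ⟨1, 2, one_pos, one_lt_two⟩

/-- Truncated, shifted and mollified function. -/
noncomputable def cutoffMollify (V : ℝ → ℂ) (n : ℕ) (x : ℝ) : ℂ :=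
  (cutoff (x / ((n : ℝ) + 1)) : ℂ) * mollify n V (x - 2 / ((n : ℝ) + 1))

theorem contDiff_cutoffMollify {V : ℝ → ℂ} (hV : LocallyIntegrable V) (n : ℕ) {k : ℕ∞} :
    ContDiff ℝ k (cutoffMollify V n) := by
  have h1 : ContDiff ℝ k fun x : ℝ => cutoff (x / ((n : ℝ) + 1)) :=
    cutoff.contDiff.comp (contDiff_id.div_const _)
  have h2 : ContDiff ℝ k fun x : ℝ => mollify n V (x - 2 / ((n : ℝ) + 1)) :=
    (contDiff_mollify n hV).comp (contDiff_id.sub contDiff_const)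
  exact (Complex.ofRealCLM.contDiff.comp h1).mul h2

theorem hasCompactSupport_cutoffMollify (V : ℝ → ℂ) (n : ℕ) :
    HasCompactSupport (cutoffMollify V n) := by
  have hn : ((n : ℝ) + 1) ≠ 0 := by positivity
  have h1 : HasCompactSupport fun x : ℝ => cutoff (x / ((n : ℝ) + 1)) := by
    have := cutoff.hasCompactSupport.comp_homeomorph (Homeomorph.mulRight₀ _ (inv_ne_zero hn))
    simpa [Function.comp_def, div_eq_mul_inv] using this
  exact (h1.comp_left (g := fun r : ℝ => (r : ℂ)) (by simp)).mul_right

/-- The shift to the right by `2 / (n + 1)` exceeds the kernel radius `1 / (n + 1)`, which leaves a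
gap of width `1 / (n + 1)` at the origin. -/
theorem tsupport_cutoffMollify_subset {V : ℝ → ℂ} (hV : ∀ x ≤ 0, V x = 0) (n : ℕ) :
    tsupport (cutoffMollify V n) ⊆ Set.Ioi 0 := by
  have hn : 0 < 1 / ((n : ℝ) + 1) := by positivity
  have h : tsupport (cutoffMollify V n) ⊆ Set.Ici (1 / ((n : ℝ) + 1)) := by
    refine closure_minimal (fun x hx => ?_) isClosed_Ici
    by_contra hlt
    rw [Set.mem_Ici, not_le] at hlt
    refine hx ?_
    rw [cutoffMollify, mollify_eq_zero n hV, mul_zero]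
    have : 2 / ((n : ℝ) + 1) = 2 * (1 / ((n : ℝ) + 1)) := by ring
    rw [this]
    linarith
  exact h.trans fun x hx => hn.trans_le hx

theorem hasDerivAt_cutoffMollify {V V₁ : ℝ → ℂ} {s : Set ℝ} (hs : s.Countable)
    (hV : Continuous V) (hV₁ : LocallyIntegrable V₁) (hd : ∀ x ∉ s, HasDerivAt V (V₁ x) x)
    (n : ℕ) (x : ℝ) : HasDerivAt (cutoffMollify V n)
      (((deriv cutoff (x / ((n : ℝ) + 1)) * (1 / ((n : ℝ) + 1)) : ℝ) : ℂ)
        * mollify n V (x - 2 / ((n : ℝ) + 1)) + cutoffMollify V₁ n x) x := by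
  have h1 : HasDerivAt (fun x : ℝ => cutoff (x / ((n : ℝ) + 1)))
      (deriv cutoff (x / ((n : ℝ) + 1)) * (1 / ((n : ℝ) + 1))) x :=
    ((cutoff.contDiff.differentiable (n := 1) (by norm_num) _).hasDerivAt).comp x
      ((hasDerivAt_id x).div_const _)
  have h2 := (hasDerivAt_mollify n hs hV hV₁ hd (x - 2 / ((n : ℝ) + 1))).scomp x
    ((hasDerivAt_id x).sub_const (2 / ((n : ℝ) + 1)))
  rw [one_smul] at h2
  exact h1.ofReal_comp.mul h2

theorem norm_mollify_shift_le (n : ℕ) {V : ℝ → ℂ} {C d : ℝ} (hd : 0 ≤ d)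
    (hV : ∀ x, ‖V x‖ ≤ C * Real.exp (-d * x)) (x : ℝ) :
    ‖mollify n V (x - 2 / ((n : ℝ) + 1))‖ ≤ C * Real.exp (3 * d) * Real.exp (-d * x) := by
  have hC : 0 ≤ C := by simpa using (norm_nonneg _).trans (hV 0)
  refine (norm_mollify_le n hd hV _).trans ?_
  rw [mul_assoc, mul_assoc, ← Real.exp_add, ← Real.exp_add]
  refine mul_le_mul_of_nonneg_left (Real.exp_le_exp.2 ?_) hC
  have h : 2 / ((n : ℝ) + 1) ≤ 2 := by
    rw [div_le_iff₀ (by positivity)]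
    have : (0 : ℝ) ≤ n := n.cast_nonneg
    linarith
  nlinarith

theorem norm_cutoffMollify_le (n : ℕ) {V : ℝ → ℂ} {C d : ℝ} (hd : 0 ≤ d)
    (hV : ∀ x, ‖V x‖ ≤ C * Real.exp (-d * x)) (x : ℝ) :
    ‖cutoffMollify V n x‖ ≤ C * Real.exp (3 * d) * Real.exp (-d * x) := by
  rw [cutoffMollify, norm_mul, Complex.norm_real, Real.norm_of_nonneg cutoff.nonneg]
  exact (mul_le_of_le_one_left (norm_nonneg _) cutoff.le_one).trans
    (norm_mollify_shift_le n hd hV x)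

theorem tendsto_mollify_shift {V : ℝ → ℂ} (hVm : AEStronglyMeasurable V) {x : ℝ}
    (hV : ContinuousAt V x) :
    Tendsto (fun n : ℕ => mollify n V (x - 2 / ((n : ℝ) + 1))) atTop (𝓝 (V x)) := by
  refine tendsto_mollify hVm hV ?_
  have h := (tendsto_one_div_add_atTop_nhds_zero_nat (𝕜 := ℝ)).const_mul 2
  simpa [div_eq_mul_inv] using h.const_sub x

theorem tendsto_div_nat_add_one (x : ℝ) :
    Tendsto (fun n : ℕ => x / ((n : ℝ) + 1)) atTop (𝓝 0) := by
  simpa [div_eq_mul_inv] using (tendsto_one_div_add_atTop_nhds_zero_nat (𝕜 := ℝ)).const_mul x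

theorem tendsto_cutoffMollify {V : ℝ → ℂ} (hVm : AEStronglyMeasurable V) {x : ℝ}
    (hV : ContinuousAt V x) :
    Tendsto (fun n : ℕ => cutoffMollify V n x) atTop (𝓝 (V x)) := by
  have h1 : Tendsto (fun n : ℕ => cutoff (x / ((n : ℝ) + 1))) atTop (𝓝 1) := by
    have h := (cutoff.continuous.tendsto 0).comp (tendsto_div_nat_add_one x)
    rwa [cutoff.one_of_mem_closedBall (Metric.mem_closedBall_self cutoff.rIn_pos.le)] at h
  have h2 := ((Complex.continuous_ofReal.tendsto 1).comp h1).mul (tendsto_mollify_shift hVm hV)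
  rwa [Complex.ofReal_one, one_mul] at h2

theorem memH10_of_expDecay {v v₁ : ℝ → ℂ} (hv₁ : Continuous v₁)
    (hd : ∀ x, HasDerivAt v (v₁ x) x) (h0 : v 0 = 0) (he : ExpDecay v) (he₁ : ExpDecay v₁) :
    MemH10 v := by
  have hv : Continuous v := continuous_iff_continuousAt.2 fun x => (hd x).continuousAt
  obtain ⟨C, d, hC, hd0, hb, hb₁⟩ := he.exists_common_bound he₁
  set V : ℝ → ℂ := fun x => v (max x 0) with hV
  set V₁ : ℝ → ℂ := (Set.Ioi 0).indicator v₁ with hV₁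
  have hVc : Continuous V := by fun_prop
  have hV₁i : LocallyIntegrable V₁ := hv₁.locallyIntegrable.indicator measurableSet_Ioi
  have hVneg : ∀ x ≤ 0, V x = 0 := fun x hx => by simp only [hV, max_eq_right hx, h0]
  have hVpos : ∀ x > 0, V x = v x := fun x hx => by simp only [hV, max_eq_left (le_of_lt hx)]
  have hV₁neg : ∀ x ≤ 0, V₁ x = 0 := fun x hx =>
    Set.indicator_of_notMem (not_lt.2 hx) _
  have hV₁pos : ∀ x > 0, V₁ x = v₁ x := fun x hx => Set.indicator_of_mem hx _
  -- Since `v 0 = 0`, the extension by zero is continuous; its derivative may jump, but only at `0`.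
  have hVd : ∀ x ∉ ({0} : Set ℝ), HasDerivAt V (V₁ x) x := by
    intro x hx
    rcases lt_or_gt_of_ne (show x ≠ 0 from hx) with h | h
    · rw [hV₁neg x h.le]
      refine (hasDerivAt_const x (0 : ℂ)).congr_of_eventuallyEq ?_
      filter_upwards [gt_mem_nhds h] with y hy using hVneg y hy.le
    · rw [hV₁pos x h]
      refine (hd x).congr_of_eventuallyEq ?_
      filter_upwards [lt_mem_nhds h] with y hy using hVpos y hy
  have hVb : ∀ x, ‖V x‖ ≤ C * Real.exp (-d * x) := by
    intro x
    rcases le_or_gt x 0 with h | h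
    · rw [hVneg x h, norm_zero]; positivity
    · rw [hVpos x h]; exact hb x h
  have hV₁b : ∀ x, ‖V₁ x‖ ≤ C * Real.exp (-d * x) := by
    intro x
    rcases le_or_gt x 0 with h | h
    · rw [hV₁neg x h, norm_zero]; positivity
    · rw [hV₁pos x h]; exact hb₁ x h
  have hV₁c : ∀ x > 0, ContinuousAt V₁ x := by
    intro x hx
    refine hv₁.continuousAt.congr ?_
    filter_upwards [lt_mem_nhds hx] with y hy using (hV₁pos y hy).symm
  have hcut : Continuous (deriv cutoff) := (cutoff.contDiff (n := 1)).continuous_deriv (by norm_num)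
  obtain ⟨B, hB⟩ := hcut.bounded_above_of_compact_support cutoff.hasCompactSupport.deriv
  have hB0 : 0 ≤ B := (norm_nonneg _).trans (hB 0)
  let φ : ℕ → 𝓓(halfLine, ℂ) := fun n => ⟨cutoffMollify V n,
    contDiff_cutoffMollify hVc.locallyIntegrable n, hasCompactSupport_cutoffMollify V n,
    tsupport_cutoffMollify_subset hVneg n⟩
  have hφd : ∀ n x, deriv (φ n) x
      = ((deriv cutoff (x / ((n : ℝ) + 1)) * (1 / ((n : ℝ) + 1)) : ℝ) : ℂ)
        * mollify n V (x - 2 / ((n : ℝ) + 1)) + cutoffMollify V₁ n x := fun n x =>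
    (hasDerivAt_cutoffMollify (Set.countable_singleton 0) hVc hV₁i hVd n x).deriv
  refine ⟨memLp_two_of_expDecay hv.aestronglyMeasurable he, v₁,
    hasWeakDeriv_of_hasDerivAt_off_countable Set.countable_empty hv hv₁.locallyIntegrable
      fun x _ => hd x, memLp_two_of_expDecay hv₁.aestronglyMeasurable he₁, φ, ?_, ?_⟩
  · refine tendsto_eLpNorm_two_of_dominated (C := C + C * Real.exp (3 * d)) hd0
      (fun n => (hv.sub (φ n).continuous).aestronglyMeasurable) (fun n x hx => ?_) fun x hx => ?_
    · rw [add_mul]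
      exact (norm_sub_le _ _).trans (add_le_add (hb x hx) (norm_cutoffMollify_le n hd0.le hVb x))
    · have h := (tendsto_cutoffMollify hVc.aestronglyMeasurable
        (hVc.continuousAt (x := x))).const_sub (v x)
      rwa [hVpos x hx, sub_self] at h
  · refine tendsto_eLpNorm_two_of_dominated
      (C := C + (B * (C * Real.exp (3 * d)) + C * Real.exp (3 * d))) hd0
      (fun n => (hv₁.sub (φ n).continuous_deriv).aestronglyMeasurable) (fun n x hx => ?_)
      fun x hx => ?_
    · rw [add_mul, add_mul, mul_assoc B, hφd]
      refine (norm_sub_le _ _).trans (add_le_add (hb₁ x hx) ((norm_add_le _ _).trans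
        (add_le_add ?_ (norm_cutoffMollify_le n hd0.le hV₁b x))))
      rw [norm_mul, Complex.norm_real, norm_mul]
      refine mul_le_mul ?_ (norm_mollify_shift_le n hd0.le hVb x) (norm_nonneg _) hB0
      refine (mul_le_of_le_one_right (norm_nonneg _) ?_).trans (hB _)
      rw [Real.norm_of_nonneg (by positivity), div_le_one (by positivity)]
      have : (0 : ℝ) ≤ n := n.cast_nonneg
      linarith
    -- The term where the derivative hits the cutoff carries a factor `1 / (n + 1)` and disappears
    -- in the limit.
    · have h1 := (hcut.tendsto 0).comp (tendsto_div_nat_add_one x)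
      have h2 := h1.mul (tendsto_one_div_add_atTop_nhds_zero_nat (𝕜 := ℝ))
      have h3 := ((Complex.continuous_ofReal.tendsto _).comp h2).mul
        (tendsto_mollify_shift hVc.aestronglyMeasurable (hVc.continuousAt (x := x)))
      have h4 := (h3.add (tendsto_cutoffMollify hV₁i.aestronglyMeasurable (hV₁c x hx))).const_sub
        (v₁ x)
      rw [mul_zero, Complex.ofReal_zero, zero_mul, zero_add, hV₁pos x hx, sub_self] at h4
      refine h4.congr fun n => ?_
      rw [hφd]
      rfl

/-! ### Gluing the oscillation to the decaying solution -/

theorem exists_rpow_le_exp {β d : ℝ} (hβ : 0 ≤ β) (hd : 0 < d) :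
    ∃ C, 0 ≤ C ∧ ∀ y ≥ 0, y ^ β ≤ C * Real.exp (d * y) := by
  set t := d / (β + 1) with ht
  have ht0 : 0 < t := by positivity
  refine ⟨(1 / t) ^ β, by positivity, fun y hy => ?_⟩
  have h1 : y ≤ 1 / t * Real.exp (t * y) := by
    rw [one_div, ← div_eq_inv_mul, le_div_iff₀ ht0]
    linarith [Real.add_one_le_exp (t * y)]
  calc y ^ β ≤ (1 / t * Real.exp (t * y)) ^ β := Real.rpow_le_rpow hy h1 hβ
    _ = (1 / t) ^ β * Real.exp (t * y * β) := by
      rw [Real.mul_rpow (by positivity) (Real.exp_pos _).le, ← Real.exp_mul]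
    _ ≤ _ := by
      refine mul_le_mul_of_nonneg_left (Real.exp_le_exp.2 ?_) (by positivity)
      have : t * (β + 1) = d := by rw [ht]; field_simp
      nlinarith [mul_nonneg ht0.le hy]

/-- Half of the rate `c` absorbs the power of `y`; on `(0, a]` compactness gives a bound, and the
constants are enlarged by `exp (d * a)` to compensate for the shift of origin. -/
theorem expDecay_ite {β a ε c A : ℝ} (hβ : 0 ≤ β) (hε : 0 < ε) (hc : 0 < c) {p q : ℝ → ℂ}
    (hp : Continuous p)
    (hq : ∀ x > a, ‖q x‖
      ≤ A * (1 + ((x - a) / ε) ^ β) * Real.exp (-(c * ((x - a) / ε)))) :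
    ExpDecay fun x => if x ≤ a then p x else q x := by
  obtain ⟨C, hC, hCb⟩ := exists_rpow_le_exp hβ (half_pos hc)
  obtain ⟨B, hB⟩ := isCompact_Icc.exists_bound_of_continuousOn (s := Set.Icc 0 a) hp.continuousOn
  set d : ℝ := c / (2 * ε) with hd
  have hd0 : 0 < d := by positivity
  refine ⟨max (|B| * Real.exp (d * a)) (|A| * (1 + C) * Real.exp (d * a)), d, hd0,
    fun x hx => ?_⟩
  have hE : Real.exp (d * a) * Real.exp (-d * x) = Real.exp (-(d * (x - a))) := by
    rw [← Real.exp_add]; ring_nf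
  beta_reduce
  split_ifs with h
  · calc ‖p x‖ ≤ |B| * 1 := by rw [mul_one]; exact (hB x ⟨hx.le, h⟩).trans (le_abs_self B)
      _ ≤ |B| * (Real.exp (d * a) * Real.exp (-d * x)) := by
        gcongr
        rw [hE]
        exact Real.one_le_exp (by nlinarith)
      _ ≤ _ := by rw [← mul_assoc]; gcongr; exact le_max_left _ _
  · rw [not_le] at h
    set y := (x - a) / ε with hy
    have hy0 : 0 ≤ y := div_nonneg (by linarith) hε.le
    have hdy : d * (x - a) = c / 2 * y := by rw [hd, hy]; field_simp
    have h1 : 1 + y ^ β ≤ (1 + C) * Real.exp (c / 2 * y) := by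
      have := hCb y hy0
      have := Real.one_le_exp (show 0 ≤ c / 2 * y by positivity)
      nlinarith
    calc ‖q x‖ ≤ A * (1 + y ^ β) * Real.exp (-(c * y)) := hq x h
      _ ≤ |A| * ((1 + C) * Real.exp (c / 2 * y)) * Real.exp (-(c * y)) := by
        gcongr
        exact le_abs_self A
      _ = |A| * (1 + C) * (Real.exp (d * a) * Real.exp (-d * x)) := by
        rw [hE, hdy, mul_assoc, mul_assoc, mul_assoc, ← Real.exp_add]; ring_nf
      _ ≤ _ := by rw [← mul_assoc]; gcongr; exact le_max_right _ _

theorem hasDerivAt_ite {a : ℝ} {p p' q q' : ℝ → ℂ} (hp : ∀ x, HasDerivAt p (p' x) x)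
    (hq : ∀ x > a, HasDerivAt q (q' x) x) {x : ℝ} (hx : x ≠ a) :
    HasDerivAt (fun x => if x ≤ a then p x else q x) (if x ≤ a then p' x else q' x) x := by
  rcases lt_or_gt_of_ne hx with h | h
  · rw [if_pos h.le]
    refine (hp x).congr_of_eventuallyEq ?_
    filter_upwards [gt_mem_nhds h] with y hy using if_pos (le_of_lt hy)
  · rw [if_neg (not_le.2 h)]
    refine (hq x h).congr_of_eventuallyEq ?_
    filter_upwards [lt_mem_nhds h] with y hy using if_neg (not_le.2 hy)

/-- Gluing an oscillation on `[0, a]` to a decaying solution on `[a, ∞)`. -/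
theorem exists_glued_solution {β a ε : ℝ} (hβ : 0 ≤ β) (hε : 0 < ε) {κ : ℂ}
    {S S₁ m : ℝ → ℂ} (hS : ∀ x, HasDerivAt S (S₁ x) x)
    (hS₁ : ∀ x, HasDerivAt S₁ (-κ ^ 2 * S x) x) (hm : Continuous m)
    (hre : ∃ c > 0, ∀ y, (m y).re ≤ -c) (hM : ∃ M, ∀ y ≥ 0, ‖m y‖ ≤ M * (1 + y ^ β))
    (hmd : ∀ y > 0, HasDerivAt m
      (Complex.I * ((y ^ β : ℝ) : ℂ) - (ε * κ) ^ 2 - m y ^ 2) y)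
    (hmatch : ε * S₁ a = m 0 * S a) :
    ∃ v v₁ v₂ : ℝ → ℂ, Continuous v₁ ∧ LocallyIntegrable v₂ ∧
      (∀ x, HasDerivAt v (v₁ x) x) ∧ (∀ x ≠ a, HasDerivAt v₁ (v₂ x) x) ∧
      ExpDecay v ∧ ExpDecay v₁ ∧ ExpDecay v₂ ∧ (∀ x ≤ a, v x = S x) ∧ (∀ x ≤ a, v₁ x = S₁ x) ∧
      ∀ x, v₂ x = (Complex.I * ((ε ^ (-(β + 2)) * absorbingPotential β a x : ℝ) : ℂ) - κ ^ 2)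
        * v x := by
  obtain ⟨c, hc, hre⟩ := hre
  obtain ⟨M, hM⟩ := hM
  have hεC : (ε : ℂ) ≠ 0 := by exact_mod_cast hε.ne'
  have hSc : Continuous S := continuous_iff_continuousAt.2 fun x => (hS x).continuousAt
  have hS₁c : Continuous S₁ := continuous_iff_continuousAt.2 fun x => (hS₁ x).continuousAt
  -- Exponentiating the primitive of `m` linearises the Riccati equation: `w'' = (m' + m²) w`.
  set w : ℝ → ℂ := fun y => Complex.exp (primitiveFromZero m y) with hw
  have hwd : ∀ y, HasDerivAt w (m y * w y) y := fun y => by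
    simpa only [mul_comm] using (hasDerivAt_primitiveFromZero hm y).cexp
  have hwc : Continuous w := continuous_iff_continuousAt.2 fun x => (hwd x).continuousAt
  have hw0 : w 0 = 1 := by simp [hw, primitiveFromZero_zero]
  have hwb : ∀ y ≥ 0, ‖w y‖ ≤ Real.exp (-(c * y)) := by
    intro y hy
    have h := re_primitiveFromZero_sub_le hm hre hy
    rw [primitiveFromZero_zero, sub_zero, sub_zero] at h
    rw [hw, Complex.norm_exp]
    exact Real.exp_le_exp.2 h
  have hyd : ∀ x : ℝ, HasDerivAt (fun x : ℝ => (x - a) / ε) (1 / ε) x := fun x =>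
    ((hasDerivAt_id x).sub_const a).div_const ε
  have hyc : Continuous fun x : ℝ => (x - a) / ε := by fun_prop
  have hypos : ∀ x > a, 0 < (x - a) / ε := fun x hx => div_pos (by linarith) hε
  set q : ℝ → ℂ := fun x => S a * w ((x - a) / ε) with hq
  set q₁ : ℝ → ℂ := fun x => S a / ε * (m ((x - a) / ε) * w ((x - a) / ε)) with hq₁
  set q₂ : ℝ → ℂ := fun x => S a / ε ^ 2 *
    ((Complex.I * ((((x - a) / ε) ^ β : ℝ) : ℂ) - (ε * κ) ^ 2) * w ((x - a) / ε)) with hq₂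
  have hqd : ∀ x > a, HasDerivAt q (q₁ x) x := by
    intro x _
    refine (((hwd _).scomp x (hyd x)).const_mul (S a)).congr_deriv ?_
    simp only [hq₁, Complex.real_smul]
    push_cast
    ring
  have hq₁d : ∀ x > a, HasDerivAt q₁ (q₂ x) x := by
    intro x hx
    have h := ((hmd _ (hypos x hx)).mul (hwd ((x - a) / ε))).scomp x (hyd x)
    refine (h.const_mul (S a / ε)).congr_deriv ?_
    simp only [hq₂, Complex.real_smul]
    push_cast
    field_simp
    ring
  set v : ℝ → ℂ := fun x => if x ≤ a then S x else q x with hv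
  set v₁ : ℝ → ℂ := fun x => if x ≤ a then S₁ x else q₁ x with hv₁
  set v₂ : ℝ → ℂ := fun x => if x ≤ a then -κ ^ 2 * S x else q₂ x with hv₂
  have hvc : Continuous v := by
    refine hSc.if_le (by fun_prop) continuous_id continuous_const fun x hx => ?_
    rw [hx]
    simp [hq, hw0]
  have hv₁c : Continuous v₁ := by
    refine hS₁c.if_le (by fun_prop) continuous_id continuous_const fun x hx => ?_
    rw [hx]
    simp only [hq₁, sub_self, zero_div, hw0, mul_one]
    field_simp
    linear_combination hmatch
  have hvd : ∀ x, HasDerivAt v (v₁ x) x :=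
    -- At `a` the derivative is recovered from the continuity of `v` and `v₁`; the latter is the
    -- matching condition.
    hasDerivAt_of_hasDerivAt_of_ne' (x := a) (fun x hx => hasDerivAt_ite hS hqd hx)
      hvc.continuousAt hv₁c.continuousAt
  have hpow : Continuous fun x : ℝ => ((x - a) / ε) ^ β := hyc.rpow_const fun _ => Or.inr hβ
  have hv₂i : LocallyIntegrable v₂ := by
    have h1 : LocallyIntegrable ((Set.Iic a).indicator fun x => -κ ^ 2 * S x) :=
      (Continuous.locallyIntegrable (by fun_prop)).indicator measurableSet_Iic
    have h2 : LocallyIntegrable ((Set.Iic a)ᶜ.indicator q₂) :=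
      (Continuous.locallyIntegrable (by fun_prop)).indicator measurableSet_Iic.compl
    have h3 : v₂ = (Set.Iic a).indicator (fun x => -κ ^ 2 * S x) + (Set.Iic a)ᶜ.indicator q₂ := by
      ext x
      by_cases hx : x ≤ a <;> simp [hv₂, hx, -Set.compl_Iic]
    rw [h3]
    exact h1.add h2
  refine ⟨v, v₁, v₂, hv₁c, hv₂i, hvd, fun x hx => hasDerivAt_ite hS₁ hq₁d hx,
    expDecay_ite hβ hε hc (A := ‖S a‖) hSc fun x hx => ?_,
    expDecay_ite hβ hε hc (A := ‖S a‖ / ε * M) hS₁c fun x hx => ?_,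
    expDecay_ite hβ hε hc (A := ‖S a‖ / ε ^ 2 * (1 + ‖(ε * κ) ^ 2‖)) (by fun_prop) fun x hx => ?_,
    fun x hx => if_pos hx, fun x hx => if_pos hx, fun x => ?_⟩
  · have hy := hypos x hx
    have hp : 0 ≤ ((x - a) / ε) ^ β := by positivity
    rw [hq, norm_mul]
    exact mul_le_mul (le_mul_of_one_le_right (norm_nonneg _) (by linarith)) (hwb _ hy.le)
      (norm_nonneg _) (by positivity)
  · have hy := hypos x hx
    rw [hq₁, norm_mul, norm_mul, norm_div, Complex.norm_real, Real.norm_of_nonneg hε.le,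
      mul_assoc (‖S a‖ / ε), mul_assoc (‖S a‖ / ε)]
    gcongr
    · exact (norm_nonneg _).trans (hM _ hy.le)
    · exact hM _ hy.le
    · exact hwb _ hy.le
  · have hy := hypos x hx
    have hp : 0 ≤ ((x - a) / ε) ^ β := by positivity
    rw [hq₂, norm_mul, norm_mul, norm_div, norm_pow, Complex.norm_real,
      Real.norm_of_nonneg hε.le, mul_assoc (‖S a‖ / ε ^ 2), mul_assoc (‖S a‖ / ε ^ 2)]
    gcongr
    · refine (norm_sub_le _ _).trans ?_
      rw [norm_mul, Complex.norm_I, one_mul, Complex.norm_real, Real.norm_of_nonneg hp]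
      nlinarith [norm_nonneg ((ε * κ) ^ 2)]
    · exact hwb _ hy.le
  · by_cases hx : x ≤ a
    · simp [hv, hv₂, absorbingPotential, hx, not_lt.2 hx]
    · have hlt := not_le.1 hx
      -- A factor `ε ^ (-2)` comes from differentiating twice in `x`, and `ε ^ (-β)` from rescaling
      -- the potential.
      have h1 : ε ^ (-(β + 2)) = (ε ^ β)⁻¹ * (ε ^ 2)⁻¹ := by
        rw [Real.rpow_neg hε.le, Real.rpow_add hε, Real.rpow_two, mul_inv]
      have h2 : ((x - a) / ε) ^ β = (x - a) ^ β * (ε ^ β)⁻¹ := by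
        rw [Real.div_rpow (by linarith) hε.le, div_eq_mul_inv]
      simp only [hv, hv₂, absorbingPotential, if_neg hx, if_pos hlt, hq, hq₂, h1, h2]
      push_cast
      generalize ((ε ^ β : ℝ) : ℂ)⁻¹ = e
      field_simp

/-! ### Semiclassical scaling and eigenfunctions -/

/-- The perturbed wave number `κ = λ / h`, together with the logarithmic derivative of a decaying
solution in the rescaled absorbing region. -/
theorem exists_perturbed_frequency {β a : ℝ} (hβ : 0 ≤ β) (ha : 0 < a) {κ₀ : ℂ} (hκ₀ : κ₀ ≠ 0) :
    ∃ h₀ > (0 : ℝ), ∃ K > (0 : ℝ), ∀ h ∈ Set.Ioo (0 : ℝ) h₀,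
      ∃ (C : ℂ) (ε : ℝ) (δ κ : ℂ) (m : ℝ → ℂ), ‖C‖ < K ∧ 0 < ε ∧ κ ≠ 0 ∧ κ * a = κ₀ * a + δ ∧
        h ^ 2 * ε ^ (-(β + 2)) = 1 ∧
        h * κ = h * κ₀ + C * ((h ^ ((β + 4) / (β + 2)) : ℝ) : ℂ) ∧
        Continuous m ∧ (∃ c > 0, ∀ y, (m y).re ≤ -c) ∧
        (∃ M, ∀ y ≥ 0, ‖m y‖ ≤ M * (1 + y ^ β)) ∧
        (∀ y > 0, HasDerivAt m
          (Complex.I * ((y ^ β : ℝ) : ℂ) - (ε * κ) ^ 2 - m y ^ 2) y) ∧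
        κ * ε * Complex.cos δ = Complex.sin δ * m 0 := by
  obtain ⟨ε₀, hε₀, K, hK, hmain⟩ := exists_matching (a := a) hβ κ₀
  have haC : (a : ℂ) ≠ 0 := by exact_mod_cast ha.ne'
  have hβ2 : 0 < β + 2 := by linarith
  have hκn : 0 < ‖κ₀‖ := norm_pos_iff.2 hκ₀
  -- The second bound ensures `‖δ‖ ≤ K ε < ‖κ₀‖ a`, hence `κ ≠ 0`.
  set ε₁ : ℝ := min ε₀ (‖κ₀‖ * a / K) with hε₁
  have hε₁0 : 0 < ε₁ := by positivity
  refine ⟨ε₁ ^ ((β + 2) / 2), by positivity, K / a + 1, by positivity, fun h hh => ?_⟩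
  have hh0 : 0 < h := hh.1
  -- The length at which `h² / ε²` balances the potential `ε ^ β`.
  set ε : ℝ := h ^ (2 / (β + 2)) with hε
  have hε0 : 0 < ε := by positivity
  have hεlt : ε < ε₁ := by
    have h1 := Real.rpow_lt_rpow hh0.le hh.2 (show 0 < 2 / (β + 2) by positivity)
    rw [← Real.rpow_mul hε₁0.le] at h1
    have h2 : (β + 2) / 2 * (2 / (β + 2)) = 1 := by field_simp
    rwa [h2, Real.rpow_one] at h1
  obtain ⟨δ, m, hδ, hmc, hmre, hM, hmd, hmatch⟩ := hmain ε ⟨hε0, hεlt.trans_le (min_le_left _ _)⟩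
  have hεC : (ε : ℂ) ≠ 0 := by exact_mod_cast hε0.ne'
  refine ⟨δ / (a * ε), ε, δ, κ₀ + δ / a, m, ?_, hε0, ?_, ?_, ?_, ?_, hmc, hmre, hM, hmd, hmatch⟩
  · rw [norm_div, norm_mul, Complex.norm_real, Complex.norm_real, Real.norm_of_nonneg ha.le,
      Real.norm_of_nonneg hε0.le]
    refine lt_of_le_of_lt ?_ (lt_add_one (K / a))
    rw [div_le_div_iff₀ (by positivity) ha]
    nlinarith
  · intro h0
    have h1 : ‖κ₀‖ = ‖δ‖ / a := by
      rw [eq_neg_of_add_eq_zero_left h0, norm_neg, norm_div, Complex.norm_real,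
        Real.norm_of_nonneg ha.le]
    have h2 : ε < ‖κ₀‖ * a / K := hεlt.trans_le (min_le_right _ _)
    rw [lt_div_iff₀ hK] at h2
    rw [eq_div_iff ha.ne'] at h1
    linarith
  · field_simp
  · rw [hε, ← Real.rpow_mul hh0.le, ← Real.rpow_two, ← Real.rpow_add hh0]
    have : 2 + 2 / (β + 2) * -(β + 2) = 0 := by field_simp; ring
    rw [this, Real.rpow_zero]
  · have h1 : h ^ ((β + 4) / (β + 2)) = h * ε := by
      have : (β + 4) / (β + 2) = 1 + 2 / (β + 2) := by field_simp; ring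
      rw [this, Real.rpow_add hh0, Real.rpow_one]
    rw [h1]
    push_cast
    field_simp

/-- A matched oscillation `S` on `[0, a]` extends to an eigenfunction. -/
theorem exists_eigenfunction {β a ε h : ℝ} (hβ : 0 ≤ β) (ha : 0 < a) (hε : 0 < ε) {κ : ℂ}
    (hh : h ^ 2 * ε ^ (-(β + 2)) = 1)
    {S S₁ m : ℝ → ℂ} (hS : ∀ x, HasDerivAt S (S₁ x) x)
    (hS₁ : ∀ x, HasDerivAt S₁ (-κ ^ 2 * S x) x) (hm : Continuous m)
    (hre : ∃ c > 0, ∀ y, (m y).re ≤ -c) (hM : ∃ M, ∀ y ≥ 0, ‖m y‖ ≤ M * (1 + y ^ β))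
    (hmd : ∀ y > 0, HasDerivAt m
      (Complex.I * ((y ^ β : ℝ) : ℂ) - (ε * κ) ^ 2 - m y ^ 2) y)
    (hmatch : ε * S₁ a = m 0 * S a) (hne : S 0 ≠ 0 ∨ S₁ 0 ≠ 0) :
    ∃ v v₁ : ℝ → ℂ, Continuous v₁ ∧ (∀ x, HasDerivAt v (v₁ x) x) ∧ v 0 = S 0 ∧ v₁ 0 = S₁ 0 ∧
      ExpDecay v ∧ ExpDecay v₁ ∧ MemH2 v ∧ ¬ (v =ᵐ[halfLineMeasure] 0) ∧
      HasWeakDeriv v v₁ ∧ SolvesCAP β a h (h * κ) v := by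
  obtain ⟨v, v₁, v₂, hv₁c, hv₂i, hvd, hv₁d, he, he₁, he₂, hvS, hvS₁, hode⟩ :=
    exists_glued_solution hβ hε hS hS₁ hm hre hM hmd hmatch
  have hvc : Continuous v := continuous_iff_continuousAt.2 fun x => (hvd x).continuousAt
  have hw₁ : HasWeakDeriv v v₁ := hasWeakDeriv_of_hasDerivAt_off_countable Set.countable_empty hvc
    hv₁c.locallyIntegrable fun x _ => hvd x
  have hw₂ : HasWeakDeriv v₁ v₂ := hasWeakDeriv_of_hasDerivAt_off_countable
    (Set.countable_singleton a) hv₁c hv₂i hv₁d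
  refine ⟨v, v₁, hv₁c, hvd, hvS 0 ha.le, hvS₁ 0 ha.le, he, he₁,
    memH2_of_expDecay hw₁ hw₂ he he₁ he₂, fun h0 => ?_, hw₁, v₁, v₂, hw₁, hw₂,
    ae_of_all _ fun x => ?_⟩
  -- If `v` vanished almost everywhere, continuity up to `0` would annihilate both Cauchy data
  -- there.
  · have hz : Set.EqOn v 0 (Set.Ioi 0) :=
      Measure.eqOn_open_of_ae_eq h0 isOpen_Ioi hvc.continuousOn continuousOn_const
    have hz₁ : Set.EqOn v₁ 0 (Set.Ioi 0) := by
      intro x hx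
      refine (hvd x).unique ((hasDerivAt_const x (0 : ℂ)).congr_of_eventuallyEq ?_)
      filter_upwards [Ioi_mem_nhds hx] with y hy using hz hy
    have h0mem : (0 : ℝ) ∈ closure (Set.Ioi (0 : ℝ)) := by rw [closure_Ioi]; exact Set.self_mem_Ici
    have e := hz.closure hvc continuous_const h0mem
    have e₁ := hz₁.closure hv₁c continuous_const h0mem
    rw [hvS 0 ha.le] at e
    rw [hvS₁ 0 ha.le] at e₁
    rcases hne with hne | hne
    · exact hne e
    · exact hne e₁
  · have hhC : (h : ℂ) ^ 2 * ((ε ^ (-(β + 2)) : ℝ) : ℂ) = 1 := by exact_mod_cast hh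
    rw [hode x]
    push_cast
    linear_combination (-(Complex.I * (absorbingPotential β a x : ℂ) * v x)) * hhC

/-! ### Trigonometric matching and the main theorem -/

theorem hasDerivAt_sin_mul (κ : ℂ) (x : ℝ) :
    HasDerivAt (fun x : ℝ => Complex.sin (κ * x)) (κ * Complex.cos (κ * x)) x := by
  have h := (((hasDerivAt_id (x : ℂ)).const_mul κ).csin).comp_ofReal
  simpa [mul_comm] using h

theorem hasDerivAt_cos_mul (κ : ℂ) (x : ℝ) :
    HasDerivAt (fun x : ℝ => Complex.cos (κ * x)) (-(κ * Complex.sin (κ * x))) x := by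
  have h := (((hasDerivAt_id (x : ℂ)).const_mul κ).ccos).comp_ofReal
  simpa [mul_comm] using h

theorem complex_cos_int_mul_pi (n : ℤ) : Complex.cos (n * Real.pi) = (-1) ^ n := by
  have h := congrArg (fun r : ℝ => (r : ℂ)) (Real.cos_int_mul_pi n)
  push_cast at h
  exact h

theorem complex_sin_add_int_mul_pi (z : ℂ) (n : ℤ) :
    Complex.sin (z + n * Real.pi) = (-1) ^ n * Complex.sin z := by
  rw [Complex.sin_add, Complex.sin_int_mul_pi, complex_cos_int_mul_pi]; ring

theorem complex_cos_add_int_mul_pi (z : ℂ) (n : ℤ) :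
    Complex.cos (z + n * Real.pi) = (-1) ^ n * Complex.cos z := by
  rw [Complex.cos_add, Complex.sin_int_mul_pi, complex_cos_int_mul_pi]; ring

theorem mainTheorem3 (β a : ℝ) (hβ : 0 ≤ β) (ha : 0 < a) :
    (∀ l : ℤ, l ≠ 0 → ∃ h₀ > (0 : ℝ), ∃ K > (0 : ℝ), ∀ h ∈ Set.Ioo (0 : ℝ) h₀,
      ∃ C : ℂ, ‖C‖ < K ∧ ∃ v : ℝ → ℂ, MemH2 v ∧ MemH10 v ∧ ¬ (v =ᵐ[halfLineMeasure] 0) ∧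
        SolvesCAP β a h (capEigenvalue β a l h C) v ∧ HasBoundaryValue v 0) ∧
    (∀ l : ℝ, (∃ n : ℤ, l + 1 / 2 = n) → ∃ h₀ > (0 : ℝ), ∃ K > (0 : ℝ),
      ∀ h ∈ Set.Ioo (0 : ℝ) h₀,
      ∃ C : ℂ, ‖C‖ < K ∧ ∃ v : ℝ → ℂ, MemH2 v ∧ ¬ (v =ᵐ[halfLineMeasure] 0) ∧
        SolvesCAP β a h (capEigenvalue β a l h C) v ∧ HasBoundaryDeriv v 0) := by
  have haC : (a : ℂ) ≠ 0 := by exact_mod_cast ha.ne'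
  have hpiC : (Real.pi : ℂ) ≠ 0 := by exact_mod_cast Real.pi_ne_zero
  have hcap : ∀ {l h : ℝ} {C κ : ℂ}, (h : ℂ) * κ = h * (Real.pi * l / a)
      + C * ((h ^ ((β + 4) / (β + 2)) : ℝ) : ℂ) → capEigenvalue β a l h C = h * κ := by
    intro l h C κ he
    rw [capEigenvalue, he]
    push_cast
    ring
  refine ⟨fun l hl => ?_, fun l ⟨n, hn⟩ => ?_⟩
  · have hlC : (l : ℂ) ≠ 0 := by exact_mod_cast hl
    obtain ⟨h₀, hh₀, K, hK, hmain⟩ := exists_perturbed_frequency hβ ha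
      (κ₀ := Real.pi * (l : ℝ) / a) (by simp [haC, hpiC, hlC])
    refine ⟨h₀, hh₀, K, hK, fun h hh => ?_⟩
    obtain ⟨C, ε, δ, κ, m, hC, hε, hκ, hκa, hhε, hlam, hmc, hre, hM, hmd, hmatch⟩ := hmain h hh
    have hκa' : κ * a = δ + l * Real.pi := by
      rw [hκa]; push_cast; field_simp; ring
    obtain ⟨v, v₁, hv₁c, hvd, hv0, -, he, he₁, hH2, hne, -, hsol⟩ := exists_eigenfunction
      (S := fun x : ℝ => Complex.sin (κ * x)) (S₁ := fun x : ℝ => κ * Complex.cos (κ * x))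
      hβ ha hε hhε (hasDerivAt_sin_mul κ)
      (fun x => ((hasDerivAt_cos_mul κ x).const_mul κ).congr_deriv (by ring)) hmc hre hM hmd
      (by
        simp only [hκa', complex_sin_add_int_mul_pi, complex_cos_add_int_mul_pi]
        linear_combination (-1 : ℂ) ^ l * hmatch)
      (Or.inr (by simpa using hκ))
    have hv0' : v 0 = 0 := by rw [hv0]; simp
    have hvc : Continuous v := continuous_iff_continuousAt.2 fun x => (hvd x).continuousAt
    refine ⟨C, hC, v, hH2, memH10_of_expDecay hv₁c hvd hv0' he he₁, hne, ?_, v, hvc.continuousOn,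
      ae_eq_rfl, hv0'⟩
    rw [hcap hlam]
    exact hsol
  · have hl : l ≠ 0 := by
      rintro rfl
      have h1 : (1 : ℝ) = ((2 * n : ℤ) : ℝ) := by push_cast; linarith
      have h2 : (1 : ℤ) = 2 * n := by exact_mod_cast h1
      omega
    have hlC : (l : ℂ) ≠ 0 := by exact_mod_cast hl
    obtain ⟨h₀, hh₀, K, hK, hmain⟩ := exists_perturbed_frequency hβ ha
      (κ₀ := Real.pi * l / a) (by simp [haC, hpiC, hlC])
    refine ⟨h₀, hh₀, K, hK, fun h hh => ?_⟩
    obtain ⟨C, ε, δ, κ, m, hC, hε, hκ, hκa, hhε, hlam, hmc, hre, hM, hmd, hmatch⟩ := hmain h hh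
    have hlC' : (l : ℂ) = n - 1 / 2 := by
      have : l = n - 1 / 2 := by linarith
      rw [this]; push_cast; ring
    -- The quarter-period shift turns `cos (κa)` into `± sin δ` and `-sin (κa)` into `± cos δ` with
    -- the same sign, so the Dirichlet matching equation reappears.
    have hκa' : κ * a = δ + n * Real.pi - Real.pi / 2 := by
      rw [hκa, hlC']; field_simp; ring
    obtain ⟨v, v₁, hv₁c, -, -, hv₁0, -, -, hH2, hne, hw₁, hsol⟩ := exists_eigenfunction
      (S := fun x : ℝ => Complex.cos (κ * x)) (S₁ := fun x : ℝ => -(κ * Complex.sin (κ * x)))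
      hβ ha hε hhε (hasDerivAt_cos_mul κ)
      (fun x => ((hasDerivAt_sin_mul κ x).const_mul κ).neg.congr_deriv (by ring)) hmc hre hM hmd
      (by
        simp only [hκa', Complex.sin_sub_pi_div_two, Complex.cos_sub_pi_div_two,
          complex_sin_add_int_mul_pi, complex_cos_add_int_mul_pi]
        linear_combination (-1 : ℂ) ^ n * hmatch)
      (Or.inl (by simp))
    refine ⟨C, hC, v, hH2, hne, ?_, v₁, hw₁, v₁, hv₁c.continuousOn, ae_eq_rfl, ?_⟩
    · rw [hcap hlam]
      exact hsol
    · rw [hv₁0]; simp
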